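/- **Setting.** Let $q$ be a prime power, let $n,\ell\ge 1$ be integers, and let $V\subseteq\mathbb F_{q^n}$ be an $\mathbb F_q$-linear subspace of dimension $k$; put $R=k/n$. Fix a basis $\alpha_1,\dots,\alpha_n$ of $\mathbb F_{q^n}$ over $\mathbb F_q$ and let $\varphi:\mathbb F_{q^n}\to\mathbb F_q^n$, $\varphi(\sum_i x_i\alpha_i)=(x_1,\dots,x_n)$ (every bijective $\mathbb F_q$-linear map is of this form). For coefficients $f_0,\dots,f_{\ell-1}\in\mathbb F_{q^n}$ let $f(X)=\sum_{i=0}^{\ell-1}f_iX^{q^i}$ and $\mathcal C_f=\varphi(f(V))=\{\varphi(f(\alpha)):\alpha\in V\}\le\mathbb F_q^n$. If $f_0,\dots,f_{\ell-1}$ are independent and uniform in $\mathbb F_{q^n}$, then $\mathcal C=\mathcal C_f$ is called a $\mathrm{PCLP}(R,\ell)$ code (with subspace $V$ and coordinate map $\varphi$). **Local properties.** For $A\in\mathbb F_q^{n\times\ell}$ let $\mathsf{Emp}_A$ be the distribution on $\mathbb F_q^\ell$ of a uniformly random row of $A$; write $A\subseteq\mathcal C$ if all columns of $A$ lie in $\mathcal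 C$. A property $\mathcal P$ of linear codes in $\mathbb F_q^n$ is *$\ell$-local* if there is a finite set $T$ of distributions on $\mathbb F_q^\ell$ such that $\mathcal C\in\mathcal P$ if and only if $A\not\subseteq\mathcal C$ for every $\tau\in T$ and every $A$ with $\mathsf{Emp}_A=\tau$. $\mathrm{RLC}(j/n)$ is the kernel of a uniformly random matrix in $\mathbb F_q^{(n-j)\times n}$, for $0\le j\le n$, and $R_{\mathrm{RLC}}(\mathcal P)=\sup\{R'\in[0,1]:\ R'=j/n,\ \Pr[\mathrm{RLC}(R')\text{ satisfies }\mathcal P]\ge 1/2\}$ (with $\sup\emptyset=0$). **Distances and entropy.** The distance of a linear code is the minimum relative Hamming distance of two distinct codewords ($+\infty$ for the zero code); the dual code is $\mathcal C^\perp=\{y:\langle x,y\rangle=0\ \forall x\in\mathcal C\}$ and the dual distance of $\mathcal C$ is the distance of $\mathcal C^\perp$. The function $h_q^{-1}:[0,1]\to[0,1-1/q]$ is the inverse of $h_q(x)=x\log_q(q-1)+x\log_q\frac1x+(1-x)\log_q\frac1{1-x}$ on $[0,1-1/q]$. **Theorem.** For every $\eta>0$ there are $c\in\mathbb R$ and $N\in\mathbb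 N$, depending only on $\eta$, such that the following holds for all $q,n,\ell,V,(\alpha_i)$ as above. 1. Let $\varepsilon>0$ and let $\mathcal P$ be an $\ell$-local property with $R\le R_{\mathrm{RLC}}(\mathcal P)-\varepsilon$. If $n\ge N$ and $n/\log_q n\ge c\,q^{2\ell}$, then $\mathcal C$ satisfies $\mathcal P$ with probability at least $1-q^{-n(\varepsilon-\eta)}$. 2. Let $0<\varepsilon\le R$. If $n\ge N$, then with probability at least $1-q^{-n(\varepsilon-\eta)}$ the dual distance of $\mathcal C$ is at least $h_q^{-1}(R-\varepsilon)$. 3. With probability at least $1-q^{-(1-R)n}$, the code $\mathcal C$ has rate (dimension divided by $n$) exactly $R$. 4. Let $0<\varepsilon\le R$ and let $\mathcal P$ be an $\ell$-local property with $R\le R_{\mathrm{RLC}}(\mathcal P)-\varepsilon$. If $n\ge N$ and $n/\log_q n\ge c\,q^{2\ell}$, then with probability at least $1-q^{-n(\varepsilon-\eta)}$ the code $\mathcal C$ satisfies $\mathcal P$, has dual distance at least $h_q^{-1}(R-\varepsilon)$, and has rate $R$, all simultaneously. 5. (The dual is essentially a $\mathrm{PCLP}(1-R,1)$ code.) Let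 $\beta_1,\dots,\beta_n$ be the basis dual to $\alpha_1,\dots,\alpha_n$ for the trace, $\mathrm{Tr}(\alpha_i\beta_j)=\delta_{ij}$, and let $\psi(\sum_i y_i\beta_i)=(y_1,\dots,y_n)$. For an $\mathbb F_q$-subspace $U\subseteq\mathbb F_{q^n}$ put $U^\perp=\{\beta:\mathrm{Tr}(\alpha\beta)=0\ \forall\alpha\in U\}$. - (a) If $f_0\ne0$ and $g=f_0^{-1}f$, then $\mathcal C_f^\perp=\psi(f_0^{-1}W)$ with $W=g(V)^\perp$. - (b) If $g=\sum_{i<\ell}g_iX^{q^i}$ is fixed with $g_0=1$ and $\dim g(V)=k$, then $W=g(V)^\perp$ has dimension $n-k=(1-R)n$, and for uniform $a\in\mathbb F_{q^n}\setminus\{0\}$ the random code $\mathcal C_{ag}^\perp$ has the same distribution as $\psi(aW)$, i.e. as the $\mathrm{PCLP}(1-R,1)$ code with subspace $W$ and coordinate map $\psi$, conditioned on its coefficient being nonzero. - (c) With probability at least $1-q^{-n}-q^{-(1-R)n}$ one has $f_0\ne0$ and $\dim f(V)=k$. In particular, for fixed $q$ and $\ell$ the probabilities in 1, 2 and 4 are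 at least $1-q^{-n(\varepsilon-o_{n\to\infty}(1))}$. -/

import Mathlib

namespace PCLP

noncomputable section

/-- The probability of the event `p` under the uniform distribution on a finite nonempty
sample space `Ω`. -/
def prob {Ω : Type*} (p : Ω → Prop) : ℝ :=
  (Nat.card {ω : Ω // p ω} : ℝ) / (Nat.card Ω : ℝ)

/-! ### The `q`-ary entropy function and its inverse -/

/-- The `q`-ary entropy function
`h_q(x) = x log_q (q-1) + x log_q (1/x) + (1-x) log_q (1/(1-x))`,
i.e. Mathlib's `q`-ary entropy (natural logarithms) rescaled to base `q`. -/
def entropy (q : ℕ) (x : ℝ) : ℝ := Real.qaryEntropy q x / Real.log q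

/-- The inverse `h_q⁻¹ : [0,1] → [0, 1-1/q]` of the `q`-ary entropy function. -/
def entropyInv (q : ℕ) (y : ℝ) : ℝ :=
  Function.invFunOn (entropy q) (Set.Icc 0 (1 - 1 / (q : ℝ))) y

theorem entropy_zero (q : ℕ) : entropy q 0 = 0 := by simp [entropy]

theorem entropy_top {q : ℕ} (hq : 2 ≤ q) : entropy q (1 - 1 / (q : ℝ)) = 1 := by
  have h2 : (2 : ℝ) ≤ q := by exact_mod_cast hq
  have hl : 0 < Real.log q := Real.log_pos (by linarith)
  have h1 : (q : ℝ) - 1 ≠ 0 := by linarith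
  have hq0 : (q : ℝ) ≠ 0 := by linarith
  have e : (1 : ℝ) - 1 / q = (q - 1) / q := by field_simp
  rw [entropy, div_eq_one_iff_eq hl.ne', Real.qaryEntropy, Real.binEntropy, e]
  have e2 : 1 - ((q : ℝ) - 1) / q = (q : ℝ)⁻¹ := by field_simp; ring
  rw [e2, inv_inv, inv_div, Real.log_div hq0 h1]
  push_cast
  field_simp
  ring

/-- On `[0,1]`, `entropyInv q` really is the (unique) inverse of `entropy q` with values in
`[0, 1-1/q]`. -/
theorem entropyInv_spec {q : ℕ} (hq : 2 ≤ q) {y : ℝ} (hy : y ∈ Set.Icc (0 : ℝ) 1) :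
    entropyInv q y ∈ Set.Icc 0 (1 - 1 / (q : ℝ)) ∧ entropy q (entropyInv q y) = y := by
  have h2 : (2 : ℝ) ≤ q := by exact_mod_cast hq
  have h0 : (0 : ℝ) ≤ 1 - 1 / (q : ℝ) := by
    rw [sub_nonneg, div_le_one (by linarith)]; linarith
  have hc : Continuous (entropy q) := by
    unfold entropy
    exact Real.qaryEntropy_continuous.div_const _
  have hmem : y ∈ entropy q '' Set.Icc 0 (1 - 1 / (q : ℝ)) := by
    apply intermediate_value_Icc h0 hc.continuousOn
    rwa [entropy_zero, entropy_top hq]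
  exact Function.invFunOn_pos (by simpa [Set.image] using hmem)

/-! ### Linear codes in `F^n` -/

section Codes

variable {F : Type*} [Field F] {n : ℕ}

/-- The rate `dim(C)/n` of a linear code `C ≤ F^n`. -/
def rate (C : Submodule F (Fin n → F)) : ℝ := (Module.finrank F C : ℝ) / n

open Classical in
/-- The relative minimum distance `min {d(x,y) : x, y ∈ C, x ≠ y}`, where `d` is the relative
Hamming distance; it is `⊤` for the zero code (minimum over the empty set). -/
def minDist (C : Submodule F (Fin n → F)) : EReal :=
  ⨅ x ∈ C, ⨅ y ∈ C, ⨅ _ : x ≠ y, (((hammingDist x y : ℝ) / n : ℝ) : EReal)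

/-- The dual code `{y : ⟨x, y⟩ = 0 for all x ∈ C}`. -/
def dualCode (C : Submodule F (Fin n → F)) : Submodule F (Fin n → F) where
  carrier := {y | ∀ x ∈ C, x ⬝ᵥ y = 0}
  add_mem' := fun {a b} ha hb x hx => by rw [dotProduct_add, ha x hx, hb x hx, add_zero]
  zero_mem' := fun x _ => dotProduct_zero x
  smul_mem' := fun c a ha x hx => by rw [dotProduct_smul, ha x hx, smul_zero]

/-- `A ⊆ C`: every column of the matrix `A` lies in the code `C`. -/
def ColsIn {ℓ : ℕ} (A : Matrix (Fin n) (Fin ℓ) F) (C : Submodule F (Fin n → F)) : Prop :=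
  ∀ j : Fin ℓ, (fun i => A i j) ∈ C

/-- The empirical row distribution of `A`: the law of the `i`-th row `A_i` of `A`, for a
uniformly random `i ∈ [n]`. -/
def empDist [NeZero n] {ℓ : ℕ} (A : Matrix (Fin n) (Fin ℓ) F) : PMF (Fin ℓ → F) :=
  (PMF.uniformOfFintype (Fin n)).map (fun i => A i)

/-- The set `M_{n,τ}` of all `n × ℓ` matrices with empirical row distribution `τ`. -/
def matricesOfType (n : ℕ) [NeZero n] {ℓ : ℕ} (τ : PMF (Fin ℓ → F)) :
    Set (Matrix (Fin n) (Fin ℓ) F) :=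
  {A | empDist A = τ}

/-- A property of linear codes of block-length `n` is `ℓ`-local if it is defined by forbidding all
matrices with `ℓ` columns whose type belongs to some finite set `T` of distributions on `F^ℓ`. -/
def IsLocalProperty [NeZero n] (ℓ : ℕ) (P : Submodule F (Fin n → F) → Prop) : Prop :=
  ∃ T : Set (PMF (Fin ℓ → F)), T.Finite ∧
    ∀ C : Submodule F (Fin n → F), P C ↔ ∀ τ ∈ T, ∀ A ∈ matricesOfType n τ, ¬ ColsIn A C

/-- The probability that a random linear code of block-length `n` and rate `k/n`, i.e. the kernel of
a uniformly random `(n-k) × n` matrix, satisfies `P`. -/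
def probRLC (k : ℕ) (P : Submodule F (Fin n → F) → Prop) : ℝ :=
  prob (fun H : Matrix (Fin (n - k)) (Fin n) F => P (LinearMap.ker H.mulVecLin))

/-- The threshold rate `R_RLC(P) = sup {R ∈ [0,1] : Pr[RLC(R) satisfies P] ≥ 1/2}`; the rates of
random linear codes of block-length `n` are the numbers `k/n` with `0 ≤ k ≤ n`. -/
def thresholdRate (P : Submodule F (Fin n → F) → Prop) : ℝ :=
  sSup {R : ℝ | ∃ k : ℕ, k ≤ n ∧ R = (k : ℝ) / n ∧ 1 / 2 ≤ probRLC k P}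

end Codes

/-! ### Linearized polynomials and the codes they define -/

section Linearized

variable (F : Type*) {K : Type*} [Fintype F] [Field K] {ℓ : ℕ}

/-- The linearized polynomial `∑_{i<ℓ} f_i X^(q^i)` with coefficients `f_0, …, f_{ℓ-1} ∈ K`, where
`q = |F|`. -/
def linearizedPoly (f : Fin ℓ → K) : Polynomial K :=
  ∑ i : Fin ℓ, Polynomial.C (f i) * Polynomial.X ^ (Fintype.card F ^ (i : ℕ))

theorem eval_linearizedPoly (f : Fin ℓ → K) (α : K) :
    (linearizedPoly F f).eval α = ∑ i : Fin ℓ, f i * α ^ (Fintype.card F ^ (i : ℕ)) := by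
  simp [linearizedPoly, Polynomial.eval_finsetSum]

variable [Field F] [Algebra F K]

/-- The `F`-linear map `α ↦ f(α)` on `K` given by the linearized polynomial `f`. -/
def linearizedMap (f : Fin ℓ → K) : K →ₗ[F] K where
  toFun := fun α => (linearizedPoly F f).eval α
  map_add' := fun a b => by
    obtain ⟨p, hp⟩ := CharP.exists F
    have := hp
    have : CharP K p := charP_of_injective_algebraMap (algebraMap F K).injective p
    obtain ⟨m, hpp, hm⟩ := FiniteField.card F p
    have : Fact p.Prime := ⟨hpp⟩
    simp only [eval_linearizedPoly, ← Finset.sum_add_distrib, ← mul_add]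
    refine Finset.sum_congr rfl fun i _ => ?_
    rw [hm, ← pow_mul, add_pow_char_pow]
  map_smul' := fun c a => by
    simp only [eval_linearizedPoly, RingHom.id_apply, Finset.smul_sum]
    refine Finset.sum_congr rfl fun i _ => ?_
    rw [smul_pow, FiniteField.pow_card_pow, mul_smul_comm]

variable {F} {n : ℕ}

/-- The code `φ(f(V))`, where `V` is an `F`-subspace of `K`, `f` is the linearized polynomial with
coefficients `f_0, …, f_{ℓ-1}` and `φ : K → F^n` is the coordinate map of the `F`-basis `b` of `K`
(every bijective `F`-linear map `K → F^n` is of this form). For uniformly random coefficients this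
is a `PCLP(dim(V)/n, ℓ)` code. -/
def code (b : Module.Basis (Fin n) F K) (V : Submodule F K) (f : Fin ℓ → K) :
    Submodule F (Fin n → F) :=
  (V.map (linearizedMap F f)).map (b.equivFun : K →ₗ[F] (Fin n → F))

/-- The orthogonal space `{β : Tr(αβ) = 0 for all α ∈ U}` with respect to the trace `K → F`. -/
def traceOrthogonal (U : Submodule F K) : Submodule F K :=
  (Algebra.traceForm F K).orthogonal U

end Linearized

end

end PCLP

/-!
Everything rests on two computations. A fixed `s`-dimensional subspace of `F^n` lies in a
random linear code of codimension `m` with probability `q^(-m s)` (`prob_le_ker`). For the codes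
`φ(f(V))` with `dim V = k` and `s ≤ ℓ` the probability is at most `q^((k - n) s)` (`prob_le_code`):
a basis of the subspace has at most `q^(k s)` tuples of preimages in `V`, such a tuple is linearly
independent, and at `s ≤ ℓ` independent points the values of `f` are independent and uniform, since
a nonzero linearized polynomial of `q`-degree less than `s` has fewer than `q^s` roots.

*Local properties.* The type class of a matrix is its orbit under permutations of the rows. Suppose
that a random linear code of codimension `m` avoids the type class of `A` with probability at least
`1/2`. The number of its members in the code then has large variance. The covariance of two members
`A`, `A'` comes from the intersection of their column spaces, which is spanned by a matrix
`A * B = A' * B'`, and for given `B`, `B'` the number of such pairs is controlled by the size of the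
type class of `A * B`, because all fibres of `A ↦ A * B` over it have the same size. Hence some
nonzero image `A * B` has a type class of size at most `4 q^(2 ℓ^2) q^(m rank (A * B))`
(`exists_card_rowOrbit_mul_le`). A code that contains `A` contains `A * B`, so for `φ(f(V))` it
suffices to take a union bound over these small type classes, of which there are at most
`(n + 1)^(q^ℓ)` (`prob_not_isLocalProperty_le`). No entropy estimate is involved, and the
hypothesis on `n / log_q n` absorbs the two error factors (`pow_mul_le_rpow_of_le_div_logb`).

*Dual distance and rate.* A nonzero word is in the dual of `φ(f(V))` with probability `q^(-k)`
(`prob_mem_dualCode`), and a union bound over the Hamming ball, of size at most `q^(n h_q(δ))`,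
bounds the dual distance. The dimension of the code is `k` unless one of the nonzero elements of
`V` is a root of `f` (`prob_finrank_map_ne_le`).

*Duality.* The coordinate maps of a basis and of its trace dual turn the dot product into the trace
form, which gives the description of the dual code (`dualCode_code_eq`). The scalar `a` is thereby
inverted, which preserves the uniform distribution on the units.
-/

namespace PCLP

/-! ### Elementary probability on finite sample spaces -/

section Probability

variable {Ω : Type*}

theorem prob_mono [Finite Ω] {p r : Ω → Prop} (h : ∀ ω, p ω → r ω) : prob p ≤ prob r := by
  unfold prob
  gcongr
  exact Nat.card_le_card_of_injective (fun x : {ω // p ω} => (⟨x.1, h _ x.2⟩ : {ω // r ω}))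
    (fun a b hab => Subtype.ext (by simpa using hab))

theorem prob_or_le [Finite Ω] (p r : Ω → Prop) : prob (fun ω => p ω ∨ r ω) ≤ prob p + prob r := by
  classical
  have := Fintype.ofFinite Ω
  unfold prob
  rw [← add_div]
  gcongr
  simp only [Nat.card_eq_fintype_card]
  exact_mod_cast Fintype.card_subtype_or p r

theorem prob_exists_le [Finite Ω] {ι : Type*} (s : Finset ι) (p : ι → Ω → Prop) :
    prob (fun ω => ∃ i ∈ s, p i ω) ≤ ∑ i ∈ s, prob (p i) := by
  classical
  induction s using Finset.induction_on with
  | empty => simp [prob]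
  | insert a s ha ih =>
    rw [Finset.sum_insert ha]
    refine le_trans (prob_mono ?_) ((prob_or_le (p a) (fun ω => ∃ i ∈ s, p i ω)).trans
      (by gcongr))
    intro ω
    simp

theorem prob_eq_one_sub [Finite Ω] [Nonempty Ω] (p : Ω → Prop) :
    prob p = 1 - prob (fun ω => ¬ p ω) := by
  classical
  have := Fintype.ofFinite Ω
  have h0 : (Fintype.card Ω : ℝ) ≠ 0 := by exact_mod_cast Fintype.card_ne_zero
  unfold prob
  simp only [Nat.card_eq_fintype_card]
  rw [Fintype.card_subtype_compl, Nat.cast_sub (Fintype.card_subtype_le _)]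
  field_simp
  ring

theorem prob_congr_equiv {Ω' : Type*} (e : Ω ≃ Ω') (p : Ω' → Prop) :
    prob (fun ω => p (e ω)) = prob p := by
  unfold prob
  rw [Nat.card_congr e, Nat.card_congr (e.subtypeEquiv (p := fun ω => p (e ω)) (q := p)
    (fun _ => Iff.rfl))]

theorem prob_eq_sum_indicator [Fintype Ω] (p : Ω → Prop) [DecidablePred p] :
    prob p * Fintype.card Ω = ∑ ω, if p ω then (1 : ℝ) else 0 := by
  unfold prob
  rcases isEmpty_or_nonempty Ω with h | h
  · simp
  have h0 : (Fintype.card Ω : ℝ) ≠ 0 := by exact_mod_cast Fintype.card_ne_zero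
  simp only [Nat.card_eq_fintype_card]
  rw [div_mul_cancel₀ _ h0, Fintype.card_subtype]
  simp

end Probability

/-! ### Subspaces contained in random linear codes -/

section Counting

variable {F : Type*} [Field F] {n : ℕ}

theorem colsIn_iff_range_le {ℓ : ℕ} (A : Matrix (Fin n) (Fin ℓ) F)
    (C : Submodule F (Fin n → F)) : ColsIn A C ↔ LinearMap.range A.mulVecLin ≤ C := by
  rw [Matrix.range_mulVecLin, Submodule.span_le, Set.range_subset_iff]
  rfl

/-- A fixed subspace `U` lies in the kernel of a uniformly random `m × n` matrix with probability
`q^(-m dim U)`: the rows of the matrix are independent, and each of them has to annihilate `U`. -/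
theorem prob_le_ker [Fintype F] (m : ℕ) (U : Submodule F (Fin n → F)) :
    prob (fun H : Matrix (Fin m) (Fin n) F => U ≤ LinearMap.ker H.mulVecLin) =
      ((Fintype.card F : ℝ) ^ (m * Module.finrank F U))⁻¹ := by
  classical
  have hq : (Fintype.card F : ℝ) ≠ 0 := by exact_mod_cast Fintype.card_ne_zero
  let e : (Fin n → F) ≃ₗ[F] Module.Dual F (Fin n → F) := dotProductEquiv F (Fin n)
  let W : Submodule F (Fin n → F) := U.dualAnnihilator.comap e.toLinearMap
  have hW : Module.finrank F W + Module.finrank F U = n := by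
    have h1 : Module.finrank F W = Module.finrank F U.dualAnnihilator := by
      rw [← LinearEquiv.finrank_map_eq e W,
        Submodule.map_comap_eq_of_surjective e.surjective]
    have h2 := Subspace.finrank_add_finrank_dualAnnihilator_eq U
    simp at h2
    omega
  have hmem : ∀ w, w ∈ W ↔ ∀ u ∈ U, w ⬝ᵥ u = 0 := by
    intro w
    simp [W, Submodule.mem_dualAnnihilator, e]
  have hc : Nat.card {H : Matrix (Fin m) (Fin n) F // U ≤ LinearMap.ker H.mulVecLin} =
      Fintype.card F ^ (m * Module.finrank F W) := by
    have e2 : {H : Matrix (Fin m) (Fin n) F // U ≤ LinearMap.ker H.mulVecLin} ≃ (Fin m → W) :=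
      { toFun := fun H i => ⟨H.1 i, (hmem _).2 fun u hu => by
          have := H.2 hu
          exact congrFun (show H.1.mulVec u = 0 from this) i⟩
        invFun := fun w => ⟨fun i => (w i).1, fun u hu => by
          rw [LinearMap.mem_ker]
          ext i
          exact (hmem _).1 (w i).2 u hu⟩
        left_inv := fun H => rfl
        right_inv := fun w => rfl }
    rw [Nat.card_congr e2, Nat.card_fun, Module.natCard_eq_pow_finrank (K := F),
      Nat.card_eq_fintype_card, Nat.card_eq_fintype_card, Fintype.card_fin, ← pow_mul, mul_comm]
  unfold prob
  rw [hc, Matrix, Nat.card_fun, Nat.card_fun]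
  simp only [Nat.card_eq_fintype_card, Fintype.card_fin]
  rw [← pow_mul, show n * m = m * Module.finrank F W + m * Module.finrank F U by
    rw [← mul_add, hW, mul_comm]]
  push_cast
  rw [pow_add]
  field_simp

end Counting

/-! ### Row permutations of a matrix -/

section Orbits

open Classical in
/-- The set of all matrices obtained from `A` by permuting its rows. It is the type class of `A`:
the set of all matrices with the empirical row distribution of `A`. -/
noncomputable def rowOrbit {F : Type*} {n : ℕ} {ι : Type*} (A : Matrix (Fin n) ι F) :
    Finset (Matrix (Fin n) ι F) :=
  Finset.univ.image fun σ : Equiv.Perm (Fin n) => A.submatrix σ id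

variable {F : Type*} {n : ℕ} {ι κ : Type*}

theorem mem_rowOrbit {A D : Matrix (Fin n) ι F} :
    D ∈ rowOrbit A ↔ ∃ σ : Equiv.Perm (Fin n), A.submatrix σ id = D := by
  simp [rowOrbit]

theorem self_mem_rowOrbit (A : Matrix (Fin n) ι F) : A ∈ rowOrbit A :=
  mem_rowOrbit.2 ⟨1, rfl⟩

theorem submatrix_mem_rowOrbit {A D : Matrix (Fin n) ι F} (h : D ∈ rowOrbit A)
    (σ : Equiv.Perm (Fin n)) : D.submatrix σ id ∈ rowOrbit A := by
  obtain ⟨τ, rfl⟩ := mem_rowOrbit.1 h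
  exact mem_rowOrbit.2 ⟨τ * σ, rfl⟩

theorem empDist_of_mem_rowOrbit {F : Type*} {ℓ : ℕ} [NeZero n] {A D : Matrix (Fin n) (Fin ℓ) F}
    (h : D ∈ rowOrbit A) : empDist D = empDist A := by
  obtain ⟨σ, rfl⟩ := mem_rowOrbit.1 h
  have h1 : (PMF.uniformOfFintype (Fin n)).map σ = PMF.uniformOfFintype (Fin n) := by
    ext i
    rw [PMF.map_apply, tsum_eq_single (σ.symm i)]
    · simp
    · intro j hj
      rw [if_neg]
      rintro rfl
      simp at hj
  unfold empDist
  conv_rhs => rw [← h1]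
  rw [PMF.map_comp]
  rfl

open Classical in
/-- Two matrices in which every row vector occurs equally often differ by a permutation of rows. -/
theorem mem_rowOrbit_of_card_eq {A D : Matrix (Fin n) ι F}
    (h : ∀ x : ι → F, (Finset.univ.filter fun i => A i = x).card =
      (Finset.univ.filter fun i => D i = x).card) : D ∈ rowOrbit A := by
  have e : ∀ x : ι → F, {i // D i = x} ≃ {i // A i = x} := fun x =>
    Fintype.equivOfCardEq (by rw [Fintype.card_subtype, Fintype.card_subtype, h x])
  refine mem_rowOrbit.2 ⟨(Equiv.sigmaFiberEquiv D).symm.trans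
    ((Equiv.sigmaCongrRight e).trans (Equiv.sigmaFiberEquiv A)), ?_⟩
  ext i j
  exact congrFun (e (D i) ⟨i, rfl⟩).2 j

variable [Field F] [Fintype ι]

theorem mul_mem_rowOrbit {A D : Matrix (Fin n) ι F} (h : D ∈ rowOrbit A)
    (B : Matrix ι κ F) : D * B ∈ rowOrbit (A * B) := by
  obtain ⟨σ, rfl⟩ := mem_rowOrbit.1 h
  exact mem_rowOrbit.2 ⟨σ, rfl⟩

theorem rank_of_mem_rowOrbit {A D : Matrix (Fin n) ι F} (h : D ∈ rowOrbit A) :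
    D.rank = A.rank := by
  classical
  obtain ⟨σ, rfl⟩ := mem_rowOrbit.1 h
  exact Matrix.rank_submatrix A σ (Equiv.refl ι)

open Classical in
/-- The map `A ↦ A * B` from the type class of `A₀` onto the type class of `A₀ * B` commutes with
the transitive actions of the symmetric group, hence all its fibres have the same size. -/
theorem card_fiber_mul_card_rowOrbit (A₀ : Matrix (Fin n) ι F) (B : Matrix ι κ F)
    {D : Matrix (Fin n) κ F} (hD : D ∈ rowOrbit (A₀ * B)) :
    ((rowOrbit A₀).filter fun A => A * B = D).card * (rowOrbit (A₀ * B)).card =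
      (rowOrbit A₀).card := by
  have h1 := Finset.card_eq_sum_card_fiberwise (s := rowOrbit A₀) (t := rowOrbit (A₀ * B))
    (f := fun A => A * B) (fun A hA => mul_mem_rowOrbit hA B)
  have h2 : ∀ E ∈ rowOrbit (A₀ * B), ((rowOrbit A₀).filter fun A => A * B = E).card =
      ((rowOrbit A₀).filter fun A => A * B = D).card := by
    intro E hE
    obtain ⟨σ, rfl⟩ := mem_rowOrbit.1 hD
    obtain ⟨τ, rfl⟩ := mem_rowOrbit.1 hE
    refine Finset.card_bij' (fun A _ => A.submatrix (τ⁻¹ * σ : Equiv.Perm (Fin n)) id)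
      (fun A _ => A.submatrix (σ⁻¹ * τ : Equiv.Perm (Fin n)) id) ?_ ?_ ?_ ?_
    · intro A hA
      rw [Finset.mem_filter] at hA ⊢
      refine ⟨submatrix_mem_rowOrbit hA.1 _, ?_⟩
      have : (A * B).submatrix (τ⁻¹ * σ : Equiv.Perm (Fin n)) id =
        A.submatrix (τ⁻¹ * σ : Equiv.Perm (Fin n)) id * B := rfl
      rw [← this, hA.2]
      ext i j
      simp
    · intro A hA
      rw [Finset.mem_filter] at hA ⊢
      refine ⟨submatrix_mem_rowOrbit hA.1 _, ?_⟩
      have : (A * B).submatrix (σ⁻¹ * τ : Equiv.Perm (Fin n)) id =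
        A.submatrix (σ⁻¹ * τ : Equiv.Perm (Fin n)) id * B := rfl
      rw [← this, hA.2]
      ext i j
      simp
    · intro A hA
      ext i j
      simp
    · intro A hA
      ext i j
      simp
  rw [h1, Finset.sum_congr rfl h2, Finset.sum_const, smul_eq_mul, mul_comm]

end Orbits

/-! ### The second moment method for random linear codes -/

section SecondMoment

variable {F : Type*} [Field F] {n ℓ : ℕ}

/-- The intersection of the column spaces of `A` and `A'` is the column space of a common right
multiple `A * B = A' * B'`. -/
theorem exists_mul_eq_mul_of_range_inf (A A' : Matrix (Fin n) (Fin ℓ) F) :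
    ∃ B B' : Matrix (Fin ℓ) (Fin ℓ) F, A * B = A' * B' ∧
      LinearMap.range (A * B).mulVecLin =
        LinearMap.range A.mulVecLin ⊓ LinearMap.range A'.mulVecLin := by
  set W := LinearMap.range A.mulVecLin ⊓ LinearMap.range A'.mulVecLin with hW
  have hr : Module.finrank F W ≤ ℓ := by
    refine (Submodule.finrank_mono inf_le_left).trans ?_
    simpa using A.mulVecLin.finrank_range_le
  -- a spanning family of `W` indexed by `Fin ℓ`
  obtain ⟨T, hT⟩ : ∃ T : (Fin ℓ → F) →ₗ[F] (Fin n → F), LinearMap.range T = W := by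
    let e := Module.finBasis F W
    obtain ⟨p, hp⟩ : ∃ p : (Fin ℓ → F) →ₗ[F] W, Function.Surjective p := by
      let i : (Fin (Module.finrank F W) → F) ≃ₗ[F] W := e.equivFun.symm
      refine ⟨i.toLinearMap ∘ₗ LinearMap.funLeft F F (Fin.castLE hr),
        i.surjective.comp (LinearMap.funLeft_surjective_of_injective _ _ _
          (Fin.castLE_injective hr))⟩
    exact ⟨W.subtype ∘ₗ p, by
      rw [LinearMap.range_comp_of_range_eq_top _ (LinearMap.range_eq_top.2 hp),
        Submodule.range_subtype]⟩
  have hfac : ∀ C : Matrix (Fin n) (Fin ℓ) F, W ≤ LinearMap.range C.mulVecLin →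
      ∃ B : Matrix (Fin ℓ) (Fin ℓ) F, C * B = LinearMap.toMatrix' T := by
    intro C hC
    have : ∀ j, ∃ v, C.mulVecLin v = T (Pi.single j 1) := fun j =>
      hC (hT ▸ LinearMap.mem_range_self T _)
    choose v hv using this
    refine ⟨Matrix.of fun i j => v j i, ?_⟩
    ext i j
    rw [LinearMap.toMatrix'_apply]
    have := congrFun (hv j) i
    exact this
  obtain ⟨B, hB⟩ := hfac A inf_le_left
  obtain ⟨B', hB'⟩ := hfac A' inf_le_right
  refine ⟨B, B', hB.trans hB'.symm, ?_⟩
  rw [hB, ← Matrix.toLin'_apply', Matrix.toLin'_toMatrix', hT]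

open Classical in
/-- Chebyshev's inequality for the number of events of a finite family that occur, all of the same
probability `p`, compared with the event that none of them occurs. -/
theorem prob_forall_not_mul_sq_le {Ω ι : Type*} [Finite Ω] [Nonempty Ω] (s : Finset ι)
    (E : ι → Ω → Prop) (p : ℝ) (hp : ∀ a ∈ s, prob (E a) = p) :
    prob (fun ω => ∀ a ∈ s, ¬ E a ω) * (s.card * p) ^ 2 ≤
      ∑ a ∈ s, ∑ b ∈ s, (prob (fun ω => E a ω ∧ E b ω) - p ^ 2) := by
  have := Fintype.ofFinite Ω
  have hΩ : (0 : ℝ) < Fintype.card Ω := by exact_mod_cast Fintype.card_pos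
  set X : Ω → ℝ := fun ω => ∑ a ∈ s, if E a ω then (1 : ℝ) else 0 with hX
  have h1 : ∑ ω, X ω = s.card * p * Fintype.card Ω := by
    rw [hX, Finset.sum_comm]
    simp_rw [← prob_eq_sum_indicator]
    rw [Finset.sum_congr rfl fun a ha => by rw [hp a ha], Finset.sum_const, nsmul_eq_mul, mul_assoc]
  have h2 : ∑ ω, X ω ^ 2 =
      (∑ a ∈ s, ∑ b ∈ s, prob (fun ω => E a ω ∧ E b ω)) * Fintype.card Ω := by
    simp_rw [hX, sq, Finset.sum_mul_sum, Finset.sum_mul, prob_eq_sum_indicator]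
    rw [Finset.sum_comm]
    refine Finset.sum_congr rfl fun a _ => ?_
    rw [Finset.sum_comm]
    refine Finset.sum_congr rfl fun b _ => Finset.sum_congr rfl fun ω _ => ?_
    by_cases ha : E a ω <;> by_cases hb : E b ω <;> simp [ha, hb]
  have h3 : ∑ ω, (X ω - s.card * p) ^ 2 =
      ∑ ω, X ω ^ 2 - 2 * (s.card * p) * ∑ ω, X ω + Fintype.card Ω * (s.card * p) ^ 2 := by
    simp_rw [sub_sq, Finset.sum_add_distrib, Finset.sum_sub_distrib, Finset.mul_sum]
    congr 1
    · congr 1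
      exact Finset.sum_congr rfl fun _ _ => by ring
    · simp
  have h4 : prob (fun ω => ∀ a ∈ s, ¬ E a ω) * Fintype.card Ω * (s.card * p) ^ 2 ≤
      ∑ ω, (X ω - s.card * p) ^ 2 := by
    rw [prob_eq_sum_indicator, Finset.sum_mul]
    refine Finset.sum_le_sum fun ω _ => ?_
    split_ifs with h
    · have : X ω = 0 := Finset.sum_eq_zero fun a ha => if_neg (h a ha)
      rw [this]
      exact le_of_eq (by ring)
    · rw [zero_mul]
      positivity
  rw [h3, h1, h2] at h4
  have h5 : ∑ a ∈ s, ∑ b ∈ s, (prob (fun ω => E a ω ∧ E b ω) - p ^ 2) =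
      ∑ a ∈ s, ∑ b ∈ s, prob (fun ω => E a ω ∧ E b ω) - (s.card * p) ^ 2 := by
    simp_rw [Finset.sum_sub_distrib, Finset.sum_const, nsmul_eq_mul]
    ring
  rw [h5]
  nlinarith

/-- Two matrices lie in a random linear code essentially independently, up to a factor that is
governed by the dimension of the intersection of their column spaces. -/
theorem prob_colsIn_ker_and [Fintype F] (m : ℕ) (A A' : Matrix (Fin n) (Fin ℓ) F)
    (h : A'.rank = A.rank) :
    prob (fun H : Matrix (Fin m) (Fin n) F =>
        ColsIn A (LinearMap.ker H.mulVecLin) ∧ ColsIn A' (LinearMap.ker H.mulVecLin)) =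
      ((Fintype.card F : ℝ) ^ (m * A.rank))⁻¹ ^ 2 *
        (Fintype.card F : ℝ) ^ (m * Module.finrank F
          ↥(LinearMap.range A.mulVecLin ⊓ LinearMap.range A'.mulVecLin)) := by
  have hq : (Fintype.card F : ℝ) ≠ 0 := by exact_mod_cast Fintype.card_ne_zero
  have h1 := Submodule.finrank_sup_add_finrank_inf_eq
    (LinearMap.range A.mulVecLin) (LinearMap.range A'.mulVecLin)
  change _ = A.rank + A'.rank at h1
  simp_rw [colsIn_iff_range_le, ← sup_le_iff]
  rw [prob_le_ker]
  set d := Module.finrank F ↥(LinearMap.range A.mulVecLin ⊔ LinearMap.range A'.mulVecLin)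
  set s := Module.finrank F ↥(LinearMap.range A.mulVecLin ⊓ LinearMap.range A'.mulVecLin)
  have h2 : m * A.rank * 2 = m * d + m * s := by
    rw [← mul_add, h1, h]; ring
  rw [inv_pow, ← pow_mul, h2, pow_add]
  field_simp

open Classical in
/-- If a random linear code of codimension `m` avoids the whole type class of `A₀` with probability
at least `1/2`, then some nonzero linear image `A₀ * B` has a small type class: the expected number
of its members in the random linear code is at most `4 q^(2 ℓ^2)`. -/
theorem exists_card_rowOrbit_mul_le [Fintype F] (m : ℕ) (A₀ : Matrix (Fin n) (Fin ℓ) F)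
    (h : 1 / 2 ≤ prob (fun H : Matrix (Fin m) (Fin n) F =>
      ∀ A ∈ rowOrbit A₀, ¬ ColsIn A (LinearMap.ker H.mulVecLin))) :
    ∃ B : Matrix (Fin ℓ) (Fin ℓ) F, A₀ * B ≠ 0 ∧
      ((rowOrbit (A₀ * B)).card : ℝ) ≤
        4 * (Fintype.card F : ℝ) ^ (2 * ℓ ^ 2) *
          (Fintype.card F : ℝ) ^ (m * (A₀ * B).rank) := by
  by_contra! hcon
  have hq : (0 : ℝ) < Fintype.card F := by exact_mod_cast Fintype.card_pos
  set q : ℝ := (Fintype.card F : ℝ) with hq_def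
  set p : ℝ := (q ^ (m * A₀.rank))⁻¹ with hp_def
  have hp0 : 0 < p := by positivity
  set O := rowOrbit A₀ with hO
  have hN : (0 : ℝ) < O.card := by
    exact_mod_cast Finset.card_pos.2 ⟨A₀, self_mem_rowOrbit A₀⟩
  have hmain := prob_forall_not_mul_sq_le O
    (fun A (H : Matrix (Fin m) (Fin n) F) => ColsIn A (LinearMap.ker H.mulVecLin)) p
    (fun A hA => by
      simp_rw [colsIn_iff_range_le]
      rw [prob_le_ker, hp_def, ← rank_of_mem_rowOrbit hA]
      rfl)
  -- the covariance of `A` and `A'` is charged to a pair `B`, `B'` with `A * B = A' * B'`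
  have hcov : ∀ A ∈ O, ∀ A' ∈ O,
      prob (fun H : Matrix (Fin m) (Fin n) F => ColsIn A (LinearMap.ker H.mulVecLin) ∧
        ColsIn A' (LinearMap.ker H.mulVecLin)) - p ^ 2 ≤
      ∑ B : Matrix (Fin ℓ) (Fin ℓ) F, ∑ B' : Matrix (Fin ℓ) (Fin ℓ) F,
        if A * B = A' * B' ∧ A₀ * B ≠ 0 then p ^ 2 * q ^ (m * (A₀ * B).rank) else 0 := by
    intro A hA A' hA'
    have hnn : ∀ B B' : Matrix (Fin ℓ) (Fin ℓ) F, (0 : ℝ) ≤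
        if A * B = A' * B' ∧ A₀ * B ≠ 0 then p ^ 2 * q ^ (m * (A₀ * B).rank) else 0 := by
      intro B B'
      split_ifs <;> positivity
    have hrk := rank_of_mem_rowOrbit hA
    have hrk' := rank_of_mem_rowOrbit hA'
    rw [prob_colsIn_ker_and m A A' (hrk'.trans hrk.symm), hrk, ← hq_def, ← hp_def]
    obtain ⟨B, B', hBB, hr⟩ := exists_mul_eq_mul_of_range_inf A A'
    rw [← hr]
    change p ^ 2 * q ^ (m * (A * B).rank) - p ^ 2 ≤ _
    have hrB := rank_of_mem_rowOrbit (mul_mem_rowOrbit hA B)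
    rw [hrB]
    by_cases h0 : A₀ * B = 0
    · rw [h0, Matrix.rank_zero, mul_zero, pow_zero, mul_one, sub_self]
      exact Finset.sum_nonneg fun B _ => Finset.sum_nonneg fun B' _ => hnn B B'
    · calc p ^ 2 * q ^ (m * (A₀ * B).rank) - p ^ 2 ≤ p ^ 2 * q ^ (m * (A₀ * B).rank) := by
            linarith [sq_nonneg p]
        _ = if A * B = A' * B' ∧ A₀ * B ≠ 0 then p ^ 2 * q ^ (m * (A₀ * B).rank) else 0 := by
            rw [if_pos ⟨hBB, h0⟩]
        _ ≤ _ := (Finset.single_le_sum (fun B' _ => hnn B B') (Finset.mem_univ B')).trans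
            (Finset.single_le_sum (f := fun B => ∑ B', if A * B = A' * B' ∧ A₀ * B ≠ 0 then
                p ^ 2 * q ^ (m * (A₀ * B).rank) else 0)
              (fun B _ => Finset.sum_nonneg fun B' _ => hnn B B') (Finset.mem_univ B))
  -- for fixed `A'`, `B`, `B'` few matrices `A` satisfy `A * B = A' * B'`
  have hfib : ∀ (B B' : Matrix (Fin ℓ) (Fin ℓ) F), ∀ A' ∈ O,
      (∑ A ∈ O, if A * B = A' * B' ∧ A₀ * B ≠ 0 then p ^ 2 * q ^ (m * (A₀ * B).rank) else 0) ≤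
        p ^ 2 * O.card / (4 * q ^ (2 * ℓ ^ 2)) := by
    intro B B' A' _
    by_cases h0 : A₀ * B = 0
    · simp only [h0, ne_eq, not_true_eq_false, and_false, if_false, Finset.sum_const_zero]
      positivity
    simp only [ne_eq, h0, not_false_eq_true, and_true]
    rw [← Finset.sum_filter, Finset.sum_const, nsmul_eq_mul]
    have hlt := hcon B h0
    by_cases hD : A' * B' ∈ rowOrbit (A₀ * B)
    · have hcard := card_fiber_mul_card_rowOrbit A₀ B hD
      rw [← hO] at hcard
      have hcard' : ((O.filter fun A => A * B = A' * B').card : ℝ) *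
          (rowOrbit (A₀ * B)).card = O.card := by
        rw [← hcard]
        push_cast
        congr!
      rw [le_div_iff₀ (by positivity)]
      calc ((O.filter fun A => A * B = A' * B').card : ℝ) *
            (p ^ 2 * q ^ (m * (A₀ * B).rank)) * (4 * q ^ (2 * ℓ ^ 2))
          = p ^ 2 * (((O.filter fun A => A * B = A' * B').card : ℝ) *
            (4 * q ^ (2 * ℓ ^ 2) * q ^ (m * (A₀ * B).rank))) := by ring
        _ ≤ p ^ 2 * (((O.filter fun A => A * B = A' * B').card : ℝ) *
            (rowOrbit (A₀ * B)).card) := by gcongr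
        _ = p ^ 2 * O.card := by rw [hcard']
    · rw [Finset.filter_false_of_mem]
      · simp only [Finset.card_empty, Nat.cast_zero, zero_mul]
        positivity
      · intro A hA hAB
        exact hD (hAB ▸ mul_mem_rowOrbit hA B)
  have hsum : ∑ A ∈ O, ∑ A' ∈ O,
      (prob (fun H : Matrix (Fin m) (Fin n) F => ColsIn A (LinearMap.ker H.mulVecLin) ∧
        ColsIn A' (LinearMap.ker H.mulVecLin)) - p ^ 2) ≤ (O.card * p) ^ 2 / 4 := by
    calc _ ≤ ∑ A ∈ O, ∑ A' ∈ O, ∑ B : Matrix (Fin ℓ) (Fin ℓ) F,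
          ∑ B' : Matrix (Fin ℓ) (Fin ℓ) F,
          (if A * B = A' * B' ∧ A₀ * B ≠ 0 then p ^ 2 * q ^ (m * (A₀ * B).rank) else 0) :=
          Finset.sum_le_sum fun A hA => Finset.sum_le_sum fun A' hA' => hcov A hA A' hA'
      _ = ∑ B : Matrix (Fin ℓ) (Fin ℓ) F, ∑ B' : Matrix (Fin ℓ) (Fin ℓ) F, ∑ A' ∈ O, ∑ A ∈ O,
          (if A * B = A' * B' ∧ A₀ * B ≠ 0 then p ^ 2 * q ^ (m * (A₀ * B).rank) else 0) := by
          rw [Finset.sum_comm]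
          simp_rw [Finset.sum_comm (s := O) (t := Finset.univ)]
      _ ≤ ∑ B : Matrix (Fin ℓ) (Fin ℓ) F, ∑ B' : Matrix (Fin ℓ) (Fin ℓ) F, ∑ A' ∈ O,
          p ^ 2 * O.card / (4 * q ^ (2 * ℓ ^ 2)) :=
          Finset.sum_le_sum fun B _ => Finset.sum_le_sum fun B' _ =>
            Finset.sum_le_sum fun A' hA' => hfib B B' A' hA'
      _ = (O.card * p) ^ 2 / 4 := by
          simp only [Finset.sum_const, nsmul_eq_mul, Finset.card_univ]
          have : Fintype.card (Matrix (Fin ℓ) (Fin ℓ) F) = Fintype.card F ^ (ℓ ^ 2) := by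
            rw [← Nat.card_eq_fintype_card, Matrix, Nat.card_fun, Nat.card_fun]
            simp only [Nat.card_eq_fintype_card, Fintype.card_fin]
            rw [← pow_mul, sq]
          rw [this]
          push_cast
          rw [← hq_def, show 2 * ℓ ^ 2 = ℓ ^ 2 + ℓ ^ 2 by ring, pow_add]
          field_simp
  have hpos : 0 < (O.card * p) ^ 2 := by positivity
  nlinarith [mul_le_mul_of_nonneg_right h hpos.le]

end SecondMoment

/-! ### Subspaces contained in a random code defined by a linearized polynomial -/

section LinearizedCodes

variable {F K : Type*} [Field F] [Fintype F] [Field K] [Algebra F K] {n ℓ : ℕ}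

theorem linearizedMap_apply (f : Fin ℓ → K) (α : K) :
    linearizedMap F f α = ∑ i : Fin ℓ, f i * α ^ (Fintype.card F ^ (i : ℕ)) :=
  eval_linearizedPoly F f α

theorem linearizedMap_sub_apply (f g : Fin ℓ → K) (α : K) :
    linearizedMap F (f - g) α = linearizedMap F f α - linearizedMap F g α := by
  simp [linearizedMap_apply, sub_mul]

theorem linearizedMap_smul_apply (a : K) (f : Fin ℓ → K) (α : K) :
    linearizedMap F (a • f) α = a * linearizedMap F f α := by
  simp [linearizedMap_apply, Finset.mul_sum, mul_assoc]

/-- A linearized polynomial of `q`-degree less than `s` that vanishes on a subspace of dimension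
`s` is zero, since it has more roots than its degree. -/
theorem eq_zero_of_le_ker_linearizedMap [Finite K] {s : ℕ} (f : Fin ℓ → K)
    (hf : ∀ i : Fin ℓ, s ≤ (i : ℕ) → f i = 0) (W : Submodule F K)
    (hW : Module.finrank F W = s) (h : W ≤ LinearMap.ker (linearizedMap F f)) : f = 0 := by
  classical
  have := Fintype.ofFinite K
  have hq : 1 < Fintype.card F := Fintype.one_lt_card
  have hpoly : linearizedPoly F f = 0 := by
    refine Polynomial.eq_zero_of_natDegree_lt_card_of_eval_eq_zero' (linearizedPoly F f)
      (Finset.univ.filter fun x => x ∈ W) (fun x hx => h (Finset.mem_filter.1 hx).2) ?_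
    have hcard : (Finset.univ.filter fun x => x ∈ W).card = Fintype.card F ^ s := by
      rw [← hW, ← Fintype.card_subtype, ← Nat.card_eq_fintype_card, ← Nat.card_eq_fintype_card]
      exact Module.natCard_eq_pow_finrank
    rw [hcard]
    refine lt_of_le_of_lt (Polynomial.natDegree_sum_le_of_forall_le
      (n := Fintype.card F ^ s - 1) _ _ fun i _ => ?_)
      (Nat.sub_lt (by positivity) one_pos)
    by_cases hi : s ≤ (i : ℕ)
    · simp [hf i hi]
    · refine (Polynomial.natDegree_C_mul_X_pow_le _ _).trans ?_
      exact Nat.le_sub_one_of_lt (Nat.pow_lt_pow_right hq (not_le.1 hi))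
  funext j
  have := congrArg (fun p => Polynomial.coeff p (Fintype.card F ^ (j : ℕ))) hpoly
  simp only [linearizedPoly, Polynomial.finsetSum_coeff, Polynomial.coeff_C_mul_X_pow,
    Polynomial.coeff_zero] at this
  rw [Finset.sum_eq_single j] at this
  · simpa using this
  · intro i _ hij
    rw [if_neg]
    intro he
    exact hij (Fin.ext (Nat.pow_right_injective hq he).symm)
  · simp

/-- At `s ≤ ℓ` linearly independent points, at most a fraction `|K|^(-s)` of the linearized
polynomials with `ℓ` coefficients take prescribed values. -/
theorem prob_linearizedMap_eq_le [Finite K] {s : ℕ} (hs : s ≤ ℓ) (v u : Fin s → K)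
    (hv : LinearIndependent F v) :
    prob (fun f : Fin ℓ → K => ∀ j, linearizedMap F f (v j) = u j) ≤
      ((Nat.card K : ℝ) ^ s)⁻¹ := by
  have hK : (0 : ℝ) < Nat.card K := by exact_mod_cast Nat.card_pos
  have h1 : Nat.card {f : Fin ℓ → K // ∀ j, linearizedMap F f (v j) = u j} ≤
      Nat.card K ^ (ℓ - s) := by
    have : Nat.card (Fin (ℓ - s) → K) = Nat.card K ^ (ℓ - s) := by simp [Nat.card_fun]
    rw [← this]
    refine Nat.card_le_card_of_injective (fun f i => f.1 ⟨s + i, by omega⟩) ?_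
    rintro ⟨f, hf⟩ ⟨g, hg⟩ hfg
    have hz : f - g = 0 := by
      refine eq_zero_of_le_ker_linearizedMap (F := F) (s := s) (f - g) (fun i hi => ?_)
        (Submodule.span F (Set.range v)) (by simpa using finrank_span_eq_card hv) ?_
      · have := congrFun hfg ⟨i - s, by omega⟩
        simp only [Nat.add_sub_cancel' hi] at this
        simpa [sub_eq_zero] using this
      · rw [Submodule.span_le]
        rintro _ ⟨j, rfl⟩
        simp [linearizedMap_sub_apply, hf j, hg j]
    exact Subtype.ext (sub_eq_zero.1 hz)
  unfold prob
  rw [Nat.card_fun, Nat.card_fin, Nat.cast_pow, div_le_iff₀ (pow_pos hK _)]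
  refine (Nat.cast_le.2 h1).trans (le_of_eq ?_)
  rw [Nat.cast_pow, eq_inv_mul_iff_mul_eq₀ (pow_pos hK _).ne', ← pow_add, Nat.add_sub_cancel' hs]

/-- A fixed subspace of dimension `s ≤ ℓ` lies in the random code `φ(f(V))` with probability at
most `(q^(k-n))^s`: there are `q^(ks)` choices for preimages of a basis. -/
theorem prob_le_code [Finite K] (b : Module.Basis (Fin n) F K) (V : Submodule F K)
    (U : Submodule F (Fin n → F)) (hU : Module.finrank F U ≤ ℓ) :
    prob (fun f : Fin ℓ → K => U ≤ code b V f) ≤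
      ((Fintype.card F : ℝ) ^ (Module.finrank F V) / (Fintype.card F : ℝ) ^ n) ^
        (Module.finrank F U) := by
  classical
  have := Fintype.ofFinite K
  set s := Module.finrank F U
  have hq : (0 : ℝ) < Fintype.card F := by exact_mod_cast Fintype.card_pos
  let w := Module.finBasis F U
  let u : Fin s → K := fun j => b.equivFun.symm (w j)
  have hu : LinearIndependent F u := by
    have h1 : LinearIndependent F (fun j => (w j : Fin n → F)) :=
      w.linearIndependent.map' U.subtype (Submodule.ker_subtype U)
    exact h1.map' b.equivFun.symm.toLinearMap (LinearEquiv.ker _)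
  have hK : Nat.card K = Fintype.card F ^ n := by
    rw [Module.natCard_eq_pow_finrank (K := F), Module.finrank_eq_card_basis b]
    simp
  calc prob (fun f : Fin ℓ → K => U ≤ code b V f)
      ≤ prob (fun f : Fin ℓ → K => ∃ v ∈ (Finset.univ : Finset (Fin s → V)),
          ∀ j, linearizedMap F f (v j) = u j) := by
        refine prob_mono fun f hf => ?_
        have : ∀ j, ∃ v : V, linearizedMap F f v = u j := by
          intro j
          obtain ⟨y, hy, hyu⟩ := Submodule.mem_map.1 (hf (w j).2)
          obtain ⟨x, hx, rfl⟩ := Submodule.mem_map.1 hy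
          refine ⟨⟨x, hx⟩, ?_⟩
          simp only [u, ← hyu]
          exact (b.equivFun.symm_apply_apply _).symm
        choose v hv using this
        exact ⟨v, Finset.mem_univ _, hv⟩
    _ ≤ ∑ v : Fin s → V, prob (fun f : Fin ℓ → K => ∀ j, linearizedMap F f (v j) = u j) :=
        prob_exists_le _ _
    _ ≤ ∑ v : Fin s → V, ((Nat.card K : ℝ) ^ s)⁻¹ := by
        refine Finset.sum_le_sum fun v _ => ?_
        by_cases hv : LinearIndependent F (fun j => (v j : K))
        · exact prob_linearizedMap_eq_le hU _ _ hv
        -- independent values can only be taken at independent points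
        · have : IsEmpty {f : Fin ℓ → K // ∀ j, linearizedMap F f (v j) = u j} := by
            refine ⟨fun f => hv (LinearIndependent.of_comp (linearizedMap F f.1) ?_)⟩
            have : (linearizedMap F f.1) ∘ (fun j => (v j : K)) = u := funext f.2
            rw [this]
            exact hu
          unfold prob
          rw [Nat.card_of_isEmpty, Nat.cast_zero, zero_div]
          positivity
    _ = _ := by
        rw [Finset.sum_const, nsmul_eq_mul, Finset.card_univ, ← Nat.card_eq_fintype_card,
          Nat.card_fun, Module.natCard_eq_pow_finrank (K := F) (V := V), hK]
        simp only [Nat.card_eq_fintype_card, Fintype.card_fin]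
        push_cast
        rw [div_pow]
        rfl

end LinearizedCodes

/-! ### Local properties of random codes -/

section LocalProperties

variable {F K : Type*} [Field F] [Fintype F] [Field K] [Algebra F K] {n ℓ : ℕ}

open Classical in
/-- A random code `φ(f(V))` rarely contains a nonzero matrix `D` whose type class is so small that
a random linear code of codimension `n - j`, with `j` at least the dimension of `V`, hardly contains
a member of it. The factor `(n + 1)^(q^ℓ)` bounds the number of type classes. -/
theorem prob_exists_colsIn_le [Finite K] (b : Module.Basis (Fin n) F K) (V : Submodule F K)
    (j : ℕ) (hj : j ≤ n) (hV : Module.finrank F V ≤ j) (M : ℝ) (hM : 0 ≤ M) :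
    prob (fun f : Fin ℓ → K => ∃ D : Matrix (Fin n) (Fin ℓ) F, D ≠ 0 ∧
        ((rowOrbit D).card : ℝ) ≤ M * (Fintype.card F : ℝ) ^ ((n - j) * D.rank) ∧
        ColsIn D (code b V f)) ≤
      ((n : ℝ) + 1) ^ (Fintype.card F ^ ℓ) * (M *
        ((Fintype.card F : ℝ) ^ (Module.finrank F V) / (Fintype.card F : ℝ) ^ j)) := by
  set q : ℝ := (Fintype.card F : ℝ) with hq_def
  have hq1 : 1 ≤ q := by
    rw [hq_def]; exact_mod_cast Fintype.card_pos
  have hq : 0 < q := by linarith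
  set k := Module.finrank F V with hk
  let S : Finset (Matrix (Fin n) (Fin ℓ) F) := Finset.univ.filter fun D =>
    D ≠ 0 ∧ ((rowOrbit D).card : ℝ) ≤ M * q ^ ((n - j) * D.rank)
  let cnt : Matrix (Fin n) (Fin ℓ) F → ((Fin ℓ → F) → Fin (n + 1)) := fun D x =>
    ⟨(Finset.univ.filter fun i => D i = x).card, by
      have := Finset.card_le_univ (Finset.univ.filter fun i => D i = x)
      rw [Fintype.card_fin] at this
      omega⟩
  have hratio : q ^ k / q ^ j ≤ 1 :=
    (div_le_one (by positivity)).2 (pow_le_pow_right₀ hq1 hV)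
  calc prob (fun f : Fin ℓ → K => ∃ D : Matrix (Fin n) (Fin ℓ) F, D ≠ 0 ∧
        ((rowOrbit D).card : ℝ) ≤ M * q ^ ((n - j) * D.rank) ∧ ColsIn D (code b V f))
      ≤ prob (fun f : Fin ℓ → K => ∃ D ∈ S, ColsIn D (code b V f)) := by
        refine prob_mono fun f => ?_
        rintro ⟨D, h1, h2, h3⟩
        exact ⟨D, Finset.mem_filter.2 ⟨Finset.mem_univ _, h1, h2⟩, h3⟩
    _ ≤ ∑ D ∈ S, prob (fun f : Fin ℓ → K => ColsIn D (code b V f)) := prob_exists_le _ _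
    _ ≤ ∑ D ∈ S, (q ^ k / q ^ n) ^ D.rank := by
        refine Finset.sum_le_sum fun D _ => ?_
        simp_rw [colsIn_iff_range_le]
        refine prob_le_code b V _ ?_
        exact D.rank_le_width
    _ = ∑ c : (Fin ℓ → F) → Fin (n + 1), ∑ D ∈ S with cnt D = c, (q ^ k / q ^ n) ^ D.rank :=
        (Finset.sum_fiberwise _ _ _).symm
    _ ≤ ∑ c : (Fin ℓ → F) → Fin (n + 1), M * (q ^ k / q ^ j) := by
        refine Finset.sum_le_sum fun c _ => ?_
        rcases (S.filter fun D => cnt D = c).eq_empty_or_nonempty with he | ⟨D₀, hD₀⟩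
        · rw [he, Finset.sum_empty]
          positivity
        obtain ⟨hS, hc⟩ := Finset.mem_filter.1 hD₀
        obtain ⟨-, hne, hsmall⟩ := Finset.mem_filter.1 hS
        have hsub : (S.filter fun D => cnt D = c) ⊆ rowOrbit D₀ := by
          intro D hD
          refine mem_rowOrbit_of_card_eq fun x => ?_
          have := congrFun (hc.trans (Finset.mem_filter.1 hD).2.symm) x
          simpa [cnt, Fin.ext_iff] using this
        have hrank : D₀.rank ≠ 0 := by
          intro h0
          have h1 : D₀.mulVecLin = 0 :=
            LinearMap.range_eq_bot.1 (Submodule.finrank_eq_zero.1 h0)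
          rw [← Matrix.toLin'_apply', LinearEquiv.map_eq_zero_iff] at h1
          exact hne h1
        calc ∑ D ∈ S with cnt D = c, (q ^ k / q ^ n) ^ D.rank
            ≤ ∑ D ∈ rowOrbit D₀, (q ^ k / q ^ n) ^ D.rank :=
              Finset.sum_le_sum_of_subset_of_nonneg hsub fun _ _ _ => by positivity
          _ = (rowOrbit D₀).card * (q ^ k / q ^ n) ^ D₀.rank := by
              rw [Finset.sum_congr rfl fun D hD => by rw [rank_of_mem_rowOrbit hD],
                Finset.sum_const, nsmul_eq_mul]
          _ ≤ M * q ^ ((n - j) * D₀.rank) * (q ^ k / q ^ n) ^ D₀.rank := by gcongr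
          _ = M * (q ^ k / q ^ j) ^ D₀.rank := by
              have hnj : q ^ n = q ^ (n - j) * q ^ j := by
                rw [← pow_add, Nat.sub_add_cancel hj]
              rw [pow_mul, mul_assoc, ← mul_pow, hnj]
              congr 2
              field_simp
          _ ≤ M * (q ^ k / q ^ j) := by
              gcongr
              exact pow_le_of_le_one (by positivity) hratio hrank
    _ = _ := by
        rw [Finset.sum_const, nsmul_eq_mul, Finset.card_univ]
        simp

/-- A local property that random linear codes of rate `j/n` satisfy with probability at least `1/2`
fails for the codes `φ(f(V))` with probability at most `q^(-(j - dim V))`, up to factors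
that are subexponential in `n` for fixed `q` and `ℓ`. -/
theorem prob_not_isLocalProperty_le [Finite K] [NeZero n] (b : Module.Basis (Fin n) F K)
    (V : Submodule F K) {P : Submodule F (Fin n → F) → Prop} (hP : IsLocalProperty ℓ P)
    (j : ℕ) (hj : j ≤ n) (hV : Module.finrank F V ≤ j) (hprob : 1 / 2 ≤ probRLC j P) :
    prob (fun f : Fin ℓ → K => ¬ P (code b V f)) ≤
      ((n : ℝ) + 1) ^ (Fintype.card F ^ ℓ) * (4 * (Fintype.card F : ℝ) ^ (2 * ℓ ^ 2) *
        ((Fintype.card F : ℝ) ^ (Module.finrank F V) / (Fintype.card F : ℝ) ^ j)) := by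
  obtain ⟨T, -, hT⟩ := hP
  refine le_trans (prob_mono fun f hf => ?_) (prob_exists_colsIn_le b V j hj hV
    (4 * (Fintype.card F : ℝ) ^ (2 * ℓ ^ 2)) (by positivity))
  rw [hT] at hf
  push Not at hf
  obtain ⟨τ, hτ, A, hA, hAC⟩ := hf
  obtain ⟨B, hB, hcard⟩ := exists_card_rowOrbit_mul_le (n - j) A (hprob.trans
    (prob_mono fun H hH A' hA' => (hT _).1 hH τ hτ A' ((empDist_of_mem_rowOrbit hA').trans hA)))
  refine ⟨A * B, hB, hcard, ?_⟩
  rw [colsIn_iff_range_le] at hAC ⊢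
  rw [Matrix.mulVecLin_mul]
  exact (LinearMap.range_comp_le_range _ _).trans hAC

/-- The threshold rate, if positive, is attained. -/
theorem exists_thresholdRate_eq {F : Type*} [Field F] {P : Submodule F (Fin n → F) → Prop}
    (h : 0 < thresholdRate P) :
    ∃ j : ℕ, j ≤ n ∧ thresholdRate P = (j : ℝ) / n ∧ 1 / 2 ≤ probRLC j P := by
  set S : Set ℝ := {R : ℝ | ∃ k : ℕ, k ≤ n ∧ R = (k : ℝ) / n ∧ 1 / 2 ≤ probRLC k P}
  have hfin : S.Finite := by
    refine (Set.finite_range fun i : Fin (n + 1) => ((i : ℕ) : ℝ) / n).subset ?_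
    rintro _ ⟨k, hk, rfl, -⟩
    exact ⟨⟨k, by omega⟩, rfl⟩
  have hne : S.Nonempty := by
    rw [Set.nonempty_iff_ne_empty]
    intro he
    have : thresholdRate P = sSup S := rfl
    rw [this, he, Real.sSup_empty] at h
    exact lt_irrefl _ h
  exact hne.csSup_mem hfin

end LocalProperties

/-! ### The rate of a random code -/

section Rate

variable {F K : Type*} [Field F] [Fintype F] [Field K] [Algebra F K] {n ℓ : ℕ}

/-- The linearized polynomial is injective on `V` unless one of the nonzero elements of `V` is a
root, which happens with probability at most `q^(-n)` for each of them. -/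
theorem prob_finrank_map_ne_le [Finite K] (hℓ : 1 ≤ ℓ) (b : Module.Basis (Fin n) F K)
    (V : Submodule F K) :
    prob (fun f : Fin ℓ → K =>
        ¬ Module.finrank F (V.map (linearizedMap F f)) = Module.finrank F V) ≤
      (Fintype.card F : ℝ) ^ (Module.finrank F V) / (Fintype.card F : ℝ) ^ n := by
  classical
  have := Fintype.ofFinite K
  have hK : Nat.card K = Fintype.card F ^ n := by
    rw [Module.natCard_eq_pow_finrank (K := F), Module.finrank_eq_card_basis b]
    simp
  have hq : (0 : ℝ) < Fintype.card F := by exact_mod_cast Fintype.card_pos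
  calc prob (fun f : Fin ℓ → K =>
        ¬ Module.finrank F (V.map (linearizedMap F f)) = Module.finrank F V)
      ≤ prob (fun f : Fin ℓ → K => ∃ v ∈ (Finset.univ : Finset V),
          (v : K) ≠ 0 ∧ linearizedMap F f v = 0) := by
        refine prob_mono fun f hf => ?_
        by_contra! hcon
        refine hf ?_
        have hinj : Function.Injective ((linearizedMap F f).domRestrict V) := by
          rw [← LinearMap.ker_eq_bot, LinearMap.ker_eq_bot']
          intro v hv
          by_contra h0
          exact hcon v (Finset.mem_univ _) (by simpa using h0) hv
        rw [← LinearMap.range_domRestrict]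
        exact LinearMap.finrank_range_of_inj hinj
    _ ≤ ∑ v : V, prob (fun f : Fin ℓ → K => (v : K) ≠ 0 ∧ linearizedMap F f v = 0) :=
        prob_exists_le _ _
    _ ≤ ∑ v : V, ((Nat.card K : ℝ) ^ 1)⁻¹ := by
        refine Finset.sum_le_sum fun v _ => ?_
        by_cases hv : (v : K) = 0
        · have : IsEmpty {f : Fin ℓ → K // (v : K) ≠ 0 ∧ linearizedMap F f v = 0} :=
            ⟨fun f => f.2.1 hv⟩
          unfold prob
          rw [Nat.card_of_isEmpty, Nat.cast_zero, zero_div]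
          positivity
        · refine le_trans (prob_mono fun f hf _ => hf.2) (prob_linearizedMap_eq_le (F := F) hℓ
            (fun _ => (v : K)) (fun _ => 0) ?_)
          exact LinearIndependent.of_subsingleton 0 hv
    _ = _ := by
        rw [Finset.sum_const, nsmul_eq_mul, Finset.card_univ, ← Nat.card_eq_fintype_card,
          Module.natCard_eq_pow_finrank (K := F) (V := V), hK]
        simp only [Nat.card_eq_fintype_card]
        push_cast
        rw [pow_one]
        rfl

theorem rate_code_eq_iff [NeZero n] (b : Module.Basis (Fin n) F K) (V : Submodule F K)
    (f : Fin ℓ → K) (k : ℕ) :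
    rate (code b V f) = (k : ℝ) / n ↔ Module.finrank F (V.map (linearizedMap F f)) = k := by
  have hn : (n : ℝ) ≠ 0 := by exact_mod_cast NeZero.ne n
  unfold rate code
  rw [LinearEquiv.finrank_map_eq, div_left_inj' hn, Nat.cast_inj]

end Rate

/-! ### The dual distance of a random code -/

section DualDistance

variable {F K : Type*} [Field F] [Fintype F] [Field K] [Algebra F K] {n ℓ : ℕ}

theorem mem_dualCode_code {b : Module.Basis (Fin n) F K} {V : Submodule F K} {f : Fin ℓ → K}
    {y : Fin n → F} :
    y ∈ dualCode (code b V f) ↔ ∀ v ∈ V, b.equivFun (linearizedMap F f v) ⬝ᵥ y = 0 := by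
  constructor
  · intro h v hv
    exact h _ (Submodule.mem_map_of_mem (Submodule.mem_map_of_mem hv))
  · rintro h _ ⟨_, ⟨v, hv, rfl⟩, rfl⟩
    exact h v hv

/-- A fixed nonzero word `y` lies in the dual of the random code with probability `q^(-k)`: already
for the coefficient `f₀`, the functional `v ↦ ⟨φ(f₀ v), y⟩` on `V` is uniformly distributed. -/
theorem prob_mem_dualCode [Finite K] [NeZero ℓ] (b : Module.Basis (Fin n) F K)
    (V : Submodule F K) (y : Fin n → F) (hy : y ≠ 0) :
    prob (fun f : Fin ℓ → K => y ∈ dualCode (code b V f)) =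
      ((Fintype.card F : ℝ) ^ (Module.finrank F V))⁻¹ := by
  classical
  have : FiniteDimensional F K := b.finiteDimensional_of_finite
  have hq : (Fintype.card F : ℝ) ≠ 0 := by exact_mod_cast Fintype.card_ne_zero
  let lam : K →ₗ[F] F := (dotProductEquiv F (Fin n) y) ∘ₗ b.equivFun.toLinearMap
  have hlam_apply : ∀ x, lam x = b.equivFun x ⬝ᵥ y := fun x => by
    simp [lam, dotProduct_comm]
  have hlam : lam ≠ 0 := by
    intro h
    refine hy ((dotProductEquiv F (Fin n)).map_eq_zero_iff.1 ?_)
    refine LinearMap.ext fun z => ?_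
    have hz : lam (b.equivFun.symm z) = 0 := by rw [h, LinearMap.zero_apply]
    simp only [lam, LinearMap.comp_apply, LinearEquiv.coe_coe,
      LinearEquiv.apply_symm_apply] at hz
    exact hz
  -- all functionals on `K` are of the form `x ↦ lam (a * x)`
  let Λ : K →ₗ[F] Module.Dual F K := (LinearMap.mul F K).compr₂ lam
  have hΛ : Function.Surjective Λ := by
    refine (LinearMap.injective_iff_surjective_of_finrank_eq_finrank
      (Subspace.dual_finrank_eq (K := F) (V := K)).symm).1 ?_
    rw [← LinearMap.ker_eq_bot, LinearMap.ker_eq_bot']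
    intro a ha
    by_contra h0
    apply hlam
    ext x
    have := congrArg (fun g => g (a⁻¹ * x)) ha
    simpa [Λ, h0] using this
  let L : (Fin ℓ → K) →ₗ[F] Module.Dual F V :=
    { toFun := fun f => lam ∘ₗ linearizedMap F f ∘ₗ V.subtype
      map_add' := fun f g => by
        ext v
        simp [linearizedMap_apply, add_mul, Finset.sum_add_distrib]
      map_smul' := fun c f => by
        ext v
        simp [linearizedMap_apply, ← Finset.smul_sum] }
  have hL : Function.Surjective L := by
    intro g
    obtain ⟨g', hg'⟩ := LinearMap.exists_extend g
    obtain ⟨a, ha⟩ := hΛ g'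
    refine ⟨Pi.single 0 a, ?_⟩
    ext v
    rw [← hg', ← ha]
    simp only [L, Λ, LinearMap.coe_mk, AddHom.coe_mk, LinearMap.comp_apply, linearizedMap_apply]
    rw [Finset.sum_eq_single 0]
    · simp
    · intro i _ hi
      simp [hi]
    · simp
  have hker : ∀ f, y ∈ dualCode (code b V f) ↔ f ∈ LinearMap.ker L := by
    intro f
    rw [mem_dualCode_code, LinearMap.mem_ker, LinearMap.ext_iff]
    simp only [Subtype.forall, L, LinearMap.coe_mk, AddHom.coe_mk, LinearMap.comp_apply,
      hlam_apply]
    rfl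
  have hfr := L.finrank_range_add_finrank_ker
  rw [LinearMap.range_eq_top.2 hL, finrank_top, Subspace.dual_finrank_eq] at hfr
  unfold prob
  simp_rw [hker]
  rw [Module.natCard_eq_pow_finrank (K := F) (V := Fin ℓ → K), ← hfr,
    show Nat.card {f // f ∈ LinearMap.ker L} = Nat.card (LinearMap.ker L) from rfl,
    Module.natCard_eq_pow_finrank (K := F) (V := LinearMap.ker L)]
  simp only [Nat.card_eq_fintype_card]
  push_cast
  rw [pow_add]
  field_simp

end DualDistance

section HammingBall

open Classical in
/-- The volume bound for Hamming balls of relative radius `δ ≤ 1 - 1/q`: under the product measure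
whose coordinates are nonzero with probability `δ`, every word of the ball has probability at least
`q^(-n h_q(δ))`. -/
theorem card_hammingNorm_le_le {F : Type*} [Field F] [Fintype F] {n : ℕ} {δ : ℝ} (hδ : 0 < δ)
    (hδ' : δ ≤ 1 - 1 / (Fintype.card F : ℝ)) :
    ((Finset.univ.filter fun y : Fin n → F => (hammingNorm y : ℝ) ≤ δ * n).card : ℝ) ≤
      (Fintype.card F : ℝ) ^ (n * entropy (Fintype.card F) δ) := by
  set q : ℝ := (Fintype.card F : ℝ) with hq_def
  have hq : 1 < q := by rw [hq_def]; exact_mod_cast Fintype.one_lt_card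
  have hq1 : 0 < q - 1 := by linarith
  have hinv : 0 < 1 / q := by positivity
  set a : ℝ := δ / (q - 1) with ha
  set c : ℝ := 1 - δ with hc
  have ha0 : 0 < a := by positivity
  have hc0 : 0 < c := by linarith
  have hac : a ≤ c := by
    rw [ha, hc, div_le_iff₀ hq1]
    have : δ * q ≤ (1 - 1 / q) * q := by gcongr
    rw [sub_mul, one_div, inv_mul_cancel₀ (by linarith)] at this
    linarith
  -- the total mass is one
  have htot : ∑ y : Fin n → F, ∏ i, (if y i = 0 then c else a) = 1 := by
    have h1 : ∑ x : F, (if x = 0 then c else a) = 1 := by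
      rw [← Finset.add_sum_erase _ _ (Finset.mem_univ (0 : F)), if_pos rfl,
        Finset.sum_congr rfl (g := fun _ => a) fun x hx => if_neg (Finset.ne_of_mem_erase hx),
        Finset.sum_const, Finset.card_erase_of_mem (Finset.mem_univ _), Finset.card_univ,
        nsmul_eq_mul, Nat.cast_sub Fintype.card_pos, ← hq_def, ha, hc]
      push_cast
      field_simp
      ring
    rw [← Fintype.piFinset_univ, Finset.sum_prod_piFinset Finset.univ
      (fun (_ : Fin n) (x : F) => if x = 0 then c else a)]
    simp [h1]
  have hmass : ∀ y : Fin n → F, (hammingNorm y : ℝ) ≤ δ * n →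
      q ^ (-(n * entropy (Fintype.card F) δ)) ≤ ∏ i, (if y i = 0 then c else a) := by
    intro y hy
    have h1 : ∏ i, (if y i = 0 then c else a) =
        Real.exp ((n - hammingNorm y) * Real.log c + hammingNorm y * Real.log a) := by
      rw [Real.exp_add, ← Real.log_rpow hc0, ← Real.log_rpow ha0, Real.exp_log (by positivity),
        Real.exp_log (by positivity), Finset.prod_ite, Finset.prod_const, Finset.prod_const]
      have h2 : (Finset.univ.filter fun i => y i = 0).card + hammingNorm y = n := by
        have := Finset.card_filter_add_card_filter_not (s := Finset.univ) (fun i => y i = 0)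
        rw [Finset.card_univ, Fintype.card_fin] at this
        convert this using 2
        simp only [hammingNorm]
      have h3 : (n : ℝ) - hammingNorm y =
          ((Finset.univ.filter fun i => y i = 0).card : ℝ) := by
        rw [sub_eq_iff_eq_add]
        exact_mod_cast h2.symm
      rw [h3, Real.rpow_natCast, Real.rpow_natCast]
      congr 2
    rw [h1, Real.rpow_def_of_pos (by linarith), Real.exp_le_exp]
    have h4 : Real.log q * -(n * entropy (Fintype.card F) δ) =
        n * ((1 - δ) * Real.log c + δ * Real.log a) := by
      have hlq : Real.log q ≠ 0 := (Real.log_pos hq).ne'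
      rw [entropy, ← hq_def, Real.qaryEntropy, Real.binEntropy, ha, hc,
        Real.log_div hδ.ne' hq1.ne', Real.log_inv, Real.log_inv]
      push_cast
      rw [← hq_def]
      field_simp
      ring
    rw [h4]
    have h5 : Real.log a ≤ Real.log c := Real.log_le_log ha0 hac
    nlinarith [mul_nonneg (sub_nonneg.2 hy) (sub_nonneg.2 h5)]
  have hsum : ((Finset.univ.filter fun y : Fin n → F => (hammingNorm y : ℝ) ≤ δ * n).card : ℝ) *
      q ^ (-(n * entropy (Fintype.card F) δ)) ≤ 1 := by
    rw [← htot, ← nsmul_eq_mul, ← Finset.sum_const]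
    refine (Finset.sum_le_sum fun y hy => hmass y (Finset.mem_filter.1 hy).2).trans ?_
    refine Finset.sum_le_sum_of_subset_of_nonneg (Finset.filter_subset _ _) fun y _ _ => ?_
    refine Finset.prod_nonneg fun i _ => ?_
    split_ifs <;> positivity
  rw [Real.rpow_neg (by linarith), ← div_eq_mul_inv, div_le_one (by positivity)] at hsum
  exact hsum

end HammingBall

section DualDistanceBound

variable {F K : Type*} [Field F] [Fintype F] [Field K] [Algebra F K] {n ℓ : ℕ}

open Classical in
/-- The dual code contains a nonzero word of weight less than `h_q⁻¹(y) n` with probability at most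
`q^(n y - k)`, by a union bound over the Hamming ball. -/
theorem prob_minDist_dualCode_lt_le [Finite K] [NeZero n] [NeZero ℓ] (b : Module.Basis (Fin n) F K)
    (V : Submodule F K) {y : ℝ} (hy : y ∈ Set.Icc (0 : ℝ) 1) :
    prob (fun f : Fin ℓ → K => ¬ (entropyInv (Fintype.card F) y : EReal) ≤
        minDist (dualCode (code b V f))) ≤
      (Fintype.card F : ℝ) ^ (n * y) * ((Fintype.card F : ℝ) ^ (Module.finrank F V))⁻¹ := by
  have hn : (0 : ℝ) < n := by exact_mod_cast Nat.pos_of_ne_zero (NeZero.ne n)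
  obtain ⟨hδ, hent⟩ := entropyInv_spec (q := Fintype.card F) Fintype.one_lt_card hy
  set δ := entropyInv (Fintype.card F) y
  let S : Finset (Fin n → F) := Finset.univ.filter fun z => (hammingNorm z : ℝ) < δ * n ∧ z ≠ 0
  have hbad : prob (fun f : Fin ℓ → K => ¬ (δ : EReal) ≤ minDist (dualCode (code b V f))) ≤
      S.card * ((Fintype.card F : ℝ) ^ (Module.finrank F V))⁻¹ := by
    calc _ ≤ prob (fun f : Fin ℓ → K => ∃ z ∈ S, z ∈ dualCode (code b V f)) := by
          refine prob_mono fun f hf => ?_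
          simp only [minDist, le_iInf_iff, not_forall, EReal.coe_le_coe_iff, not_le] at hf
          obtain ⟨x, hx, x', hx', hne, hlt⟩ := hf
          refine ⟨-x + x', Finset.mem_filter.2 ⟨Finset.mem_univ _, ?_, fun h => hne
            (neg_add_eq_zero.1 h)⟩, Submodule.add_mem _ (Submodule.neg_mem _ hx) hx'⟩
          rw [div_lt_iff₀ hn, hammingDist_eq_hammingNorm] at hlt
          exact hlt
      _ ≤ ∑ z ∈ S, prob (fun f : Fin ℓ → K => z ∈ dualCode (code b V f)) := prob_exists_le _ _
      _ = _ := by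
          rw [Finset.sum_congr rfl fun z hz => prob_mem_dualCode b V z (Finset.mem_filter.1 hz).2.2,
            Finset.sum_const, nsmul_eq_mul]
  refine hbad.trans (mul_le_mul_of_nonneg_right ?_ (by positivity))
  rcases hδ.1.eq_or_lt with h0 | hpos
  · have : S = ∅ := by
      refine Finset.filter_eq_empty_iff.2 fun z _ hz => ?_
      rw [← h0, zero_mul] at hz
      exact absurd hz.1 (not_lt.2 (Nat.cast_nonneg _))
    rw [this, Finset.card_empty, Nat.cast_zero]
    positivity
  · rw [← hent]
    refine le_trans (Nat.cast_le.2 (Finset.card_le_card ?_)) (card_hammingNorm_le_le hpos hδ.2)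
    intro z hz
    exact Finset.mem_filter.2 ⟨Finset.mem_univ _, (Finset.mem_filter.1 hz).2.1.le⟩

end DualDistanceBound

/-! ### The dual code and the trace -/

section TraceDuality

variable {F K : Type*} [Field F] [Field K] [Algebra F K] {n ℓ : ℕ}

theorem mem_traceOrthogonal {U : Submodule F K} {x : K} :
    x ∈ traceOrthogonal U ↔ ∀ u ∈ U, Algebra.trace F K (u * x) = 0 :=
  Iff.rfl

variable [Fintype F] [Finite K]

theorem equivFun_dotProduct_traceDual (b : Module.Basis (Fin n) F K) (x z : K) :
    b.equivFun z ⬝ᵥ b.traceDual.equivFun x = Algebra.trace F K (z * x) := by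
  conv_rhs => rw [← b.sum_equivFun z, Finset.sum_mul, map_sum]
  refine Finset.sum_congr rfl fun i _ => ?_
  rw [smul_mul_assoc, map_smul, smul_eq_mul, Module.Basis.equivFun_apply,
    Module.Basis.equivFun_apply, Module.Basis.traceDual_repr_apply, Algebra.traceForm_apply,
    mul_comm x]

theorem finrank_traceOrthogonal (b : Module.Basis (Fin n) F K) (U : Submodule F K) :
    Module.finrank F (traceOrthogonal U) + Module.finrank F U = n := by
  have := b.finiteDimensional_of_finite
  have h1 := LinearMap.BilinForm.finrank_orthogonal (traceForm_nondegenerate F K) U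
  have h2 := Submodule.finrank_le U
  have h3 : Module.finrank F K = n := by
    rw [Module.finrank_eq_card_basis b, Fintype.card_fin]
  unfold traceOrthogonal
  omega

/-- With `g = f₀⁻¹ f` and `y = ψ(x)`, orthogonality of `y` to the code says `Tr(g(v) f₀ x) = 0` for
all `v ∈ V`, i.e. `f₀ x ∈ g(V)^⊥`. -/
theorem dualCode_code_eq [NeZero ℓ] (b : Module.Basis (Fin n) F K) (V : Submodule F K)
    (f : Fin ℓ → K) (hf : f 0 ≠ 0) :
    dualCode (code b V f) =
      code b.traceDual (traceOrthogonal (V.map (linearizedMap F ((f 0)⁻¹ • f))))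
        (fun _ : Fin 1 => (f 0)⁻¹) := by
  ext y
  obtain ⟨x, rfl⟩ := b.traceDual.equivFun.surjective y
  have hmul : ∀ w, linearizedMap F (fun _ : Fin 1 => (f 0)⁻¹) w = (f 0)⁻¹ * w := fun w => by
    simp [linearizedMap_apply]
  have hW : f 0 * x ∈ traceOrthogonal (V.map (linearizedMap F ((f 0)⁻¹ • f))) ↔
      b.traceDual.equivFun x ∈ dualCode (code b V f) := by
    rw [mem_traceOrthogonal, mem_dualCode_code]
    simp only [Submodule.mem_map, forall_exists_index, and_imp, forall_apply_eq_imp_iff₂,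
      equivFun_dotProduct_traceDual, linearizedMap_smul_apply]
    refine forall₂_congr fun v _ => ?_
    rw [show (f 0)⁻¹ * linearizedMap F f v * (f 0 * x) = linearizedMap F f v * x by
      field_simp]
  rw [← hW]
  constructor
  · intro h
    refine Submodule.mem_map.2 ⟨x, Submodule.mem_map.2 ⟨f 0 * x, h, ?_⟩, rfl⟩
    rw [hmul, inv_mul_cancel_left₀ hf]
  · rintro ⟨_, ⟨w, hw, rfl⟩, hwx⟩
    have := b.traceDual.equivFun.injective hwx
    rw [← this, hmul, mul_inv_cancel_left₀ hf]
    exact hw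

/-- Inversion of the scalar turns the dual codes of the codes `φ(a g(V))` into the codes
`ψ(a g(V)^⊥)`. -/
theorem prob_dualCode_code_smul_eq [NeZero ℓ] (b : Module.Basis (Fin n) F K) (V : Submodule F K)
    (g : Fin ℓ → K) (hg : g 0 = 1) (D : Submodule F (Fin n → F)) :
    prob (fun a : Kˣ => dualCode (code b V ((a : K) • g)) = D) =
      prob (fun a : Kˣ => code b.traceDual (traceOrthogonal (V.map (linearizedMap F g)))
        (fun _ : Fin 1 => (a : K)) = D) := by
  rw [← prob_congr_equiv (Equiv.inv Kˣ) (fun a : Kˣ => code b.traceDual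
    (traceOrthogonal (V.map (linearizedMap F g))) (fun _ : Fin 1 => (a : K)) = D)]
  congr 1
  funext a
  have h0 : ((a : K) • g) 0 = a := by simp [hg]
  rw [dualCode_code_eq b V _ (by rw [h0]; exact a.ne_zero), h0, smul_smul,
    inv_mul_cancel₀ a.ne_zero, one_smul]
  simp

end TraceDuality

/-! ### The error terms -/

section Estimates

/-- The leading coefficient `f₀` vanishes with probability at most `|K|^(-1)`. -/
theorem prob_apply_zero_eq_zero_le {K : Type*} [Field K] [Finite K] {ℓ : ℕ} [NeZero ℓ] :
    prob (fun f : Fin ℓ → K => f 0 = 0) ≤ (Nat.card K : ℝ)⁻¹ := by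
  have hK : (0 : ℝ) < Nat.card K := by exact_mod_cast Nat.card_pos
  have h : Nat.card {f : Fin ℓ → K // f 0 = 0} * Nat.card K ≤ Nat.card (Fin ℓ → K) := by
    rw [← Nat.card_prod]
    refine Nat.card_le_card_of_injective
      (fun x : {f : Fin ℓ → K // f 0 = 0} × K => Function.update x.1.1 0 x.2) ?_
    rintro ⟨⟨f, hf⟩, a⟩ ⟨⟨g, hg⟩, c⟩ h
    have ha : a = c := by simpa using congrFun h 0
    have hfg : f = g := by
      funext i
      by_cases hi : i = 0
      · rw [hi, hf, hg]
      · simpa [hi] using congrFun h i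
    subst ha hfg
    rfl
  have hpos : (0 : ℝ) < Nat.card (Fin ℓ → K) := by exact_mod_cast Nat.card_pos
  unfold prob
  rw [div_le_iff₀ hpos, inv_mul_eq_div, le_div_iff₀ hK]
  exact_mod_cast h

/-- The number of type classes and the loss in the second moment method are absorbed into
`q^(n η / 2)` once `n / log_q n` is at least a large multiple of `q^(2ℓ)`. -/
theorem pow_mul_le_rpow_of_le_div_logb {η : ℝ} (hη : 0 < η) {q n ℓ : ℕ} (hq : 2 ≤ q) (hn : 2 ≤ n)
    (hℓ : 1 ≤ ℓ) (h : (12 / η + 2) * (q : ℝ) ^ (2 * ℓ) ≤ (n : ℝ) / Real.logb q n) :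
    ((n : ℝ) + 1) ^ (q ^ ℓ) * (4 * (q : ℝ) ^ (2 * ℓ ^ 2)) ≤ (q : ℝ) ^ (n * (η / 2)) := by
  have hqR : (2 : ℝ) ≤ q := by exact_mod_cast hq
  have hnR : (2 : ℝ) ≤ n := by exact_mod_cast hn
  have hq0 : (0 : ℝ) < q := by linarith
  have hlogq : 0 < Real.log q := Real.log_pos (by linarith)
  have hL0 : 0 < Real.logb q n := Real.logb_pos (by linarith) (by linarith)
  rw [le_div_iff₀ hL0] at h
  set L := Real.logb q n with hL
  have hqL : (q : ℝ) ^ L = n := Real.rpow_logb hq0 (by linarith) (by linarith)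
  have hQ : (q : ℝ) ^ 2 ≤ (q : ℝ) ^ (2 * ℓ) := pow_le_pow_right₀ (by linarith) (by omega)
  have hη' : 0 < 12 / η := by positivity
  -- the hypothesis forces `q ≤ n`
  have hqn : (q : ℝ) ≤ n := by
    have h1 : Real.log 2 ≤ L * Real.log q := by
      rw [hL, Real.logb, div_mul_cancel₀ _ hlogq.ne']
      exact Real.log_le_log (by norm_num) hnR
    have h2 : Real.log q ≤ q := (Real.log_le_sub_one_of_pos hq0).trans (by linarith)
    have h3 := Real.log_two_gt_d9
    have h4 : (1 : ℝ) / 2 ≤ L * q := by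
      nlinarith [mul_le_mul_of_nonneg_left h2 hL0.le]
    have h5 : 2 * (q : ℝ) ^ 2 * L ≤ (12 / η + 2) * (q : ℝ) ^ (2 * ℓ) * L := by
      gcongr
      linarith
    nlinarith
  have hL1 : 1 ≤ L := by
    rw [hL, Real.le_logb_iff_rpow_le (by linarith) (by linarith), Real.rpow_one]
    exact hqn
  have hℓq : (ℓ : ℝ) ≤ (q : ℝ) ^ ℓ := by exact_mod_cast (Nat.lt_pow_self (by omega)).le
  have hqℓ : (1 : ℝ) ≤ (q : ℝ) ^ ℓ := one_le_pow₀ (by linarith)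
  have hsq : (q : ℝ) ^ (2 * ℓ) = (q : ℝ) ^ ℓ * (q : ℝ) ^ ℓ := by rw [two_mul, pow_add]
  have h1 : ((n : ℝ) + 1) ^ (q ^ ℓ) ≤ (q : ℝ) ^ (2 * L * (q : ℝ) ^ ℓ) := by
    have h2 : (n : ℝ) + 1 ≤ (q : ℝ) ^ (2 * L) := by
      rw [mul_comm, Real.rpow_mul hq0.le, hqL, Real.rpow_two]
      nlinarith
    calc ((n : ℝ) + 1) ^ (q ^ ℓ) ≤ ((q : ℝ) ^ (2 * L)) ^ (q ^ ℓ) := by gcongr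
      _ = _ := by
        rw [← Real.rpow_natCast, ← Real.rpow_mul hq0.le]
        push_cast
        rfl
  have h4 : (4 : ℝ) ≤ (q : ℝ) ^ (2 : ℝ) := by
    rw [Real.rpow_two]
    nlinarith
  have h5 : (q : ℝ) ^ (2 * ℓ ^ 2) = (q : ℝ) ^ (2 * (ℓ : ℝ) ^ 2) := by
    rw [← Real.rpow_natCast]
    push_cast
    rfl
  calc ((n : ℝ) + 1) ^ (q ^ ℓ) * (4 * (q : ℝ) ^ (2 * ℓ ^ 2))
      ≤ (q : ℝ) ^ (2 * L * (q : ℝ) ^ ℓ) * ((q : ℝ) ^ (2 : ℝ) * (q : ℝ) ^ (2 * (ℓ : ℝ) ^ 2)) := by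
        rw [h5]
        gcongr
    _ = (q : ℝ) ^ (2 * L * (q : ℝ) ^ ℓ + (2 + 2 * (ℓ : ℝ) ^ 2)) := by
        rw [Real.rpow_add hq0, Real.rpow_add hq0]
    _ ≤ (q : ℝ) ^ (n * (η / 2)) := by
        refine Real.rpow_le_rpow_of_exponent_le (by linarith) ?_
        have h6 : 2 * L * (q : ℝ) ^ ℓ + (2 + 2 * (ℓ : ℝ) ^ 2) ≤ 6 * ((q : ℝ) ^ (2 * ℓ) * L) := by
          have e0 : (1 : ℝ) ≤ (q : ℝ) ^ (2 * ℓ) := one_le_pow₀ (by linarith)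
          have e1 : (q : ℝ) ^ ℓ * L ≤ (q : ℝ) ^ (2 * ℓ) * L := by
            rw [hsq]
            gcongr
            exact le_mul_of_one_le_left (by positivity) hqℓ
          have e2 : (ℓ : ℝ) ^ 2 ≤ (q : ℝ) ^ (2 * ℓ) := by
            rw [hsq, sq]
            gcongr
          have e3 : (q : ℝ) ^ (2 * ℓ) ≤ (q : ℝ) ^ (2 * ℓ) * L :=
            le_mul_of_one_le_right (by positivity) hL1
          calc 2 * L * (q : ℝ) ^ ℓ + (2 + 2 * (ℓ : ℝ) ^ 2)
              = 2 * ((q : ℝ) ^ ℓ * L) + 2 * 1 + 2 * (ℓ : ℝ) ^ 2 := by ring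
            _ ≤ 2 * ((q : ℝ) ^ (2 * ℓ) * L) + 2 * ((q : ℝ) ^ (2 * ℓ) * L) +
                2 * ((q : ℝ) ^ (2 * ℓ) * L) := by
              gcongr
              · exact e0.trans e3
              · exact e2.trans e3
            _ = 6 * ((q : ℝ) ^ (2 * ℓ) * L) := by ring
        have h7 : 12 / η * ((q : ℝ) ^ (2 * ℓ) * L) ≤ n := by
          refine le_trans ?_ h
          rw [mul_assoc]
          gcongr
          linarith
        have h8 : 12 * ((q : ℝ) ^ (2 * ℓ) * L) ≤ n * η := by
          rw [div_mul_eq_mul_div, div_le_iff₀ hη] at h7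
          exact h7
        linarith

theorem pow_div_pow_eq_rpow {q : ℝ} (hq : 0 < q) (k j : ℕ) :
    q ^ k / q ^ j = q ^ ((k : ℝ) - j) := by
  rw [Real.rpow_sub hq, Real.rpow_natCast, Real.rpow_natCast]

end Estimates

end PCLP

theorem mainTheorem1 (η : ℝ) (hη : 0 < η) :
    ∃ (c : ℝ) (N : ℕ),
      ∀ (F K : Type*) [Field F] [Fintype F] [Field K] [Fintype K] [Algebra F K]
        (n ℓ : ℕ) [NeZero n] [NeZero ℓ] (b : Module.Basis (Fin n) F K) (V : Submodule F K)
        (q k : ℕ) (_ : q = Fintype.card F) (_ : k = Module.finrank F V)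
        (R : ℝ) (_ : R = (k : ℝ) / n),
        -- local properties
        (∀ ε : ℝ, 0 < ε → ∀ P : Submodule F (Fin n → F) → Prop,
          PCLP.IsLocalProperty ℓ P → R ≤ PCLP.thresholdRate P - ε →
          N ≤ n → c * (q : ℝ) ^ (2 * ℓ) ≤ (n : ℝ) / Real.logb q n →
          PCLP.prob (fun f : Fin ℓ → K => P (PCLP.code b V f))
            ≥ 1 - (q : ℝ) ^ (-(n * (ε - η)))) ∧
        -- dual distance
        (∀ ε : ℝ, 0 < ε → ε ≤ R → N ≤ n →
          PCLP.prob (fun f : Fin ℓ → K =>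
              (PCLP.entropyInv q (R - ε) : EReal) ≤
                PCLP.minDist (PCLP.dualCode (PCLP.code b V f)))
            ≥ 1 - (q : ℝ) ^ (-(n * (ε - η)))) ∧
        -- rate
        PCLP.prob (fun f : Fin ℓ → K => PCLP.rate (PCLP.code b V f) = R)
          ≥ 1 - (q : ℝ) ^ (-((1 - R) * n)) ∧
        -- all three simultaneously
        (∀ ε : ℝ, 0 < ε → ε ≤ R → ∀ P : Submodule F (Fin n → F) → Prop,
          PCLP.IsLocalProperty ℓ P → R ≤ PCLP.thresholdRate P - ε →
          N ≤ n → c * (q : ℝ) ^ (2 * ℓ) ≤ (n : ℝ) / Real.logb q n →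
          PCLP.prob (fun f : Fin ℓ → K =>
              P (PCLP.code b V f) ∧
              (PCLP.entropyInv q (R - ε) : EReal) ≤
                PCLP.minDist (PCLP.dualCode (PCLP.code b V f)) ∧
              PCLP.rate (PCLP.code b V f) = R)
            ≥ 1 - (q : ℝ) ^ (-(n * (ε - η)))) ∧
        -- the dual code, in terms of the trace dual basis
        (∀ f : Fin ℓ → K, f 0 ≠ 0 →
          PCLP.dualCode (PCLP.code b V f) =
            PCLP.code b.traceDual
              (PCLP.traceOrthogonal (V.map (PCLP.linearizedMap F ((f 0)⁻¹ • f))))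
              (fun _ : Fin 1 => (f 0)⁻¹)) ∧
        (∀ g : Fin ℓ → K, g 0 = 1 →
          Module.finrank F (V.map (PCLP.linearizedMap F g)) = k →
          Module.finrank F (PCLP.traceOrthogonal (V.map (PCLP.linearizedMap F g))) + k = n ∧
          ∀ D : Submodule F (Fin n → F),
            PCLP.prob (fun a : Kˣ => PCLP.dualCode (PCLP.code b V ((a : K) • g)) = D) =
              PCLP.prob (fun a : Kˣ =>
                PCLP.code b.traceDual (PCLP.traceOrthogonal (V.map (PCLP.linearizedMap F g)))
                  (fun _ : Fin 1 => (a : K)) = D)) ∧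
        PCLP.prob (fun f : Fin ℓ → K =>
            f 0 ≠ 0 ∧ Module.finrank F (V.map (PCLP.linearizedMap F f)) = k)
          ≥ 1 - (q : ℝ) ^ (-(n : ℝ)) - (q : ℝ) ^ (-((1 - R) * n)) := by
  -- `4 / η ≤ n` pays for the union bound over three bad events
  refine ⟨12 / η + 2, ⌈4 / η⌉₊ + 2, ?_⟩
  intro F K _ _ _ _ _ n ℓ _ _ b V q k hqF hk R hR
  have hq2 : 2 ≤ q := hqF ▸ Fintype.one_lt_card
  have hqR : (2 : ℝ) ≤ q := by exact_mod_cast hq2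
  have hq0 : (0 : ℝ) < q := by linarith
  have hq1 : (1 : ℝ) ≤ q := by linarith
  have hqF' : (Fintype.card F : ℝ) = q := by rw [hqF]
  have hn0 : (0 : ℝ) < n := by exact_mod_cast Nat.pos_of_ne_zero (NeZero.ne n)
  have hℓ1 : 1 ≤ ℓ := Nat.one_le_iff_ne_zero.2 (NeZero.ne ℓ)
  have hRn : R * n = k := by rw [hR]; field_simp
  have hfrK : Module.finrank F K = n := by
    rw [Module.finrank_eq_card_basis b, Fintype.card_fin]
  have hkn : k ≤ n := by
    have := b.finiteDimensional_of_finite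
    rw [hk, ← hfrK]
    exact Submodule.finrank_le V
  have hR1 : R ≤ 1 := by
    rw [hR, div_le_one hn0]
    exact_mod_cast hkn
  have hR0 : 0 ≤ R := by rw [hR]; positivity
  have hcardK : Nat.card K = q ^ n := by
    rw [Module.natCard_eq_pow_finrank (K := F), hfrK, Nat.card_eq_fintype_card, ← hqF]
  have hlocal : ∀ ε : ℝ, 0 < ε → ∀ P : Submodule F (Fin n → F) → Prop,
      PCLP.IsLocalProperty ℓ P → R ≤ PCLP.thresholdRate P - ε → ⌈4 / η⌉₊ + 2 ≤ n →
      (12 / η + 2) * (q : ℝ) ^ (2 * ℓ) ≤ (n : ℝ) / Real.logb q n →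
      PCLP.prob (fun f : Fin ℓ → K => ¬ P (PCLP.code b V f)) ≤
        (q : ℝ) ^ (-(n * (ε - η / 2))) ∧ R ≤ 1 - ε := by
    intro ε hε P hP hRP hN hc
    obtain ⟨j, hj, hth, hprob⟩ :=
      PCLP.exists_thresholdRate_eq (P := P) (by linarith)
    have hj1 : (j : ℝ) / n ≤ 1 := (div_le_one hn0).2 (by exact_mod_cast hj)
    have hkj : (k : ℝ) - j ≤ -(n * ε) := by
      have h1 : R + ε ≤ (j : ℝ) / n := by linarith
      rw [le_div_iff₀ hn0, add_mul, hRn] at h1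
      linarith
    have hVj : Module.finrank F V ≤ j := by
      rw [← hk]
      have h1 : 0 < (n : ℝ) * ε := by positivity
      have h2 : (k : ℝ) ≤ j := by linarith
      exact_mod_cast h2
    refine ⟨?_, by linarith⟩
    refine (PCLP.prob_not_isLocalProperty_le b V hP j hj hVj hprob).trans ?_
    rw [hqF', ← hqF, ← hk, PCLP.pow_div_pow_eq_rpow hq0, ← mul_assoc]
    calc _ ≤ (q : ℝ) ^ (n * (η / 2)) * (q : ℝ) ^ (-(n * ε)) :=
          mul_le_mul (PCLP.pow_mul_le_rpow_of_le_div_logb hη hq2 (by omega) hℓ1 hc)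
            (Real.rpow_le_rpow_of_exponent_le hq1 hkj) (by positivity) (by positivity)
      _ = _ := by
          rw [← Real.rpow_add hq0]
          congr 1
          ring
  have hdual : ∀ ε : ℝ, 0 < ε → ε ≤ R →
      PCLP.prob (fun f : Fin ℓ → K => ¬ (PCLP.entropyInv q (R - ε) : EReal) ≤
        PCLP.minDist (PCLP.dualCode (PCLP.code b V f))) ≤ (q : ℝ) ^ (-(n * ε)) := by
    intro ε hε hεR
    have h1 := PCLP.prob_minDist_dualCode_lt_le (ℓ := ℓ) b V (y := R - ε)
      ⟨by linarith, by linarith⟩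
    rw [hqF', ← hqF, ← hk] at h1
    refine h1.trans (le_of_eq ?_)
    rw [← Real.rpow_natCast, ← Real.rpow_neg hq0.le, ← Real.rpow_add hq0, ← hRn]
    congr 1
    ring
  have hdim : PCLP.prob (fun f : Fin ℓ → K =>
      ¬ Module.finrank F (V.map (PCLP.linearizedMap F f)) = k) ≤
        (q : ℝ) ^ (-((1 - R) * n)) := by
    have h1 := PCLP.prob_finrank_map_ne_le hℓ1 b V
    rw [hqF', ← hk, PCLP.pow_div_pow_eq_rpow hq0] at h1
    refine h1.trans (le_of_eq ?_)
    rw [← hRn]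
    congr 1
    ring
  have hrate : ∀ f : Fin ℓ → K, PCLP.rate (PCLP.code b V f) = R ↔
      Module.finrank F (V.map (PCLP.linearizedMap F f)) = k := fun f => by
    rw [hR]
    exact PCLP.rate_code_eq_iff b V f k
  refine ⟨?_, ?_, ?_, ?_, ?_, ?_, ?_⟩
  · intro ε hε P hP hRP hN hc
    rw [PCLP.prob_eq_one_sub, ge_iff_le]
    refine sub_le_sub_left ((hlocal ε hε P hP hRP hN hc).1.trans ?_) 1
    refine Real.rpow_le_rpow_of_exponent_le hq1 (neg_le_neg ?_)
    gcongr
    linarith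
  · intro ε hε hεR _
    rw [PCLP.prob_eq_one_sub, ge_iff_le]
    refine sub_le_sub_left ((hdual ε hε hεR).trans ?_) 1
    refine Real.rpow_le_rpow_of_exponent_le hq1 (neg_le_neg ?_)
    gcongr
    linarith
  · rw [PCLP.prob_eq_one_sub, ge_iff_le]
    simp_rw [hrate]
    exact sub_le_sub_left hdim 1
  · intro ε hε hεR P hP hRP hN hc
    rw [PCLP.prob_eq_one_sub, ge_iff_le]
    refine sub_le_sub_left ?_ 1
    obtain ⟨h1, hRε⟩ := hlocal ε hε P hP hRP hN hc
    have h2 := hdual ε hε hεR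
    have hmono : ∀ x : ℝ, x ≤ -(n * (ε - η / 2)) →
        (q : ℝ) ^ x ≤ (q : ℝ) ^ (-(n * (ε - η / 2))) := fun x hx =>
      Real.rpow_le_rpow_of_exponent_le hq1 hx
    have hnη : 0 < n * (η / 2) := by positivity
    have hb2 := hmono (-(n * ε)) (by linarith)
    have hb3 := hmono (-((1 - R) * n)) (by nlinarith)
    have h4 : (4 : ℝ) ≤ (q : ℝ) ^ (n * (η / 2)) := by
      have hnη2 : (2 : ℝ) ≤ n * (η / 2) := by
        have e1 : 4 / η ≤ n := (Nat.le_ceil _).trans (by exact_mod_cast (by omega))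
        rw [div_le_iff₀ hη] at e1
        linarith
      refine le_trans ?_ (Real.rpow_le_rpow_of_exponent_le hq1 hnη2)
      rw [Real.rpow_two]
      nlinarith
    have hpos : 0 < (q : ℝ) ^ (-(n * (ε - η / 2))) := by positivity
    calc _ ≤ PCLP.prob (fun f : Fin ℓ → K => ¬ P (PCLP.code b V f) ∨
          (¬ (PCLP.entropyInv q (R - ε) : EReal) ≤
              PCLP.minDist (PCLP.dualCode (PCLP.code b V f)) ∨
            ¬ Module.finrank F (V.map (PCLP.linearizedMap F f)) = k)) := by
          refine PCLP.prob_mono fun f hf => ?_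
          rw [hrate] at hf
          tauto
      _ ≤ _ := (PCLP.prob_or_le _ _).trans (add_le_add_right (PCLP.prob_or_le _ _) _)
      _ ≤ 4 * (q : ℝ) ^ (-(n * (ε - η / 2))) := by linarith
      _ ≤ (q : ℝ) ^ (n * (η / 2)) * (q : ℝ) ^ (-(n * (ε - η / 2))) := by gcongr
      _ = _ := by
          rw [← Real.rpow_add hq0]
          congr 1
          ring
  · exact fun f hf => PCLP.dualCode_code_eq b V f hf
  · intro g hg hgk
    refine ⟨?_, PCLP.prob_dualCode_code_smul_eq b V g hg⟩
    have := PCLP.finrank_traceOrthogonal b (V.map (PCLP.linearizedMap F g))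
    rwa [hgk] at this
  · rw [PCLP.prob_eq_one_sub, ge_iff_le, sub_sub]
    refine sub_le_sub_left ?_ 1
    calc _ ≤ PCLP.prob (fun f : Fin ℓ → K => f 0 = 0 ∨
          ¬ Module.finrank F (V.map (PCLP.linearizedMap F f)) = k) :=
          PCLP.prob_mono fun f hf => by tauto
      _ ≤ _ := PCLP.prob_or_le _ _
      _ ≤ _ := by
          refine add_le_add (PCLP.prob_apply_zero_eq_zero_le.trans (le_of_eq ?_)) hdim
          rw [hcardK, Real.rpow_neg hq0.le, Real.rpow_natCast]
          push_cast
          rfl
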